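/- All graphs are finite, simple and undirected. For a connected graph $G$, an edge-coloring of $G$ (adjacent edges may receive the same color) is called a 3-rainbow coloring if for every set $S$ of three vertices of $G$ there is a tree in $G$ that contains $S$ and no two edges of which have the same color; the 3-rainbow index $rx_3(G)$ is the minimum number of colors in a 3-rainbow coloring of $G$. Let $\delta(G)$ denote the minimum degree and $\mathrm{diam}(G)$ the diameter of $G$. (1) For every connected graph $G$ on $n$ vertices with $\delta(G)\ge 3$, $rx_3(G)\le \frac34 n+3$. (2) For every connected graph $G$ on $n$ vertices with $\delta(G)\ge 4$, $rx_3(G)\le \frac35 n+\frac{17}5$. (3) For every connected graph $G$ on $n$ vertices with $\delta(G)\ge 5$, $rx_3(G)\le \frac12 n+3$. Moreover, these bounds are tight up to an additive constant: there are connected graphs $G$ of arbitrarily large order $n$ with $\delta(G)=3$ and $rx_3(G)\ge\frac34 n-\frac52$, with $\delta(G)=4$ and $rx_3(G)\ge\frac35 n-\frac{11}5$, and with $\delta(G)=5$ and $rx_3(G)\ge\frac12 n-2$, respectively. More precisely, for integers $\delta\ge3$ and $m\ge0$ let $G^*_{\delta,m}$ be the following chain of cliques: take disjoint complete graphs $X_0,X_1,\dots,X_{m+1}$,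 where $X_0$ and $X_{m+1}$ have $\delta+2$ vertices and $X_1,\dots,X_m$ have $\delta+1$ vertices; choose two distinct vertices $x_{i,1},x_{i,2}$ in each $X_i$; join $x_{i,2}$ to $x_{i+1,1}$ by an edge for $0\le i\le m$; and delete the edge $x_{i,1}x_{i,2}$ for $0\le i\le m+1$. Then $G^*_{\delta,m}$ is connected, has minimum degree $\delta$ and $n=(\delta+1)m+2(\delta+2)$ vertices, and $$rx_3(G^*_{\delta,m})\ \ge\ \mathrm{diam}(G^*_{\delta,m})\ =\ \frac{3}{\delta+1}\,n-\frac{\delta+7}{\delta+1}.$$ -/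

import Mathlib

namespace SimpleGraph

variable {V : Type*}

/-- An edge-colored graph is rainbow if no two of its edges share the same color: here, the
subgraph `T` of a graph `G` whose edges are colored by `c` (adjacent edges of `G` may have the
same color). -/
def Subgraph.IsRainbow {G : SimpleGraph V} {K : Type*} (T : G.Subgraph)
    (c : G.EdgeLabeling K) : Prop :=
  ∀ e f : G.edgeSet, (e : Sym2 V) ∈ T.edgeSet → (f : Sym2 V) ∈ T.edgeSet → c e = c f → e = f

/-- A rainbow `S`-tree: a subgraph of `G` that is a tree, contains all vertices of `S`, and is
rainbow for the edge-coloring `c`. -/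
def Subgraph.IsRainbowSteinerTree {G : SimpleGraph V} {K : Type*} (T : G.Subgraph)
    (c : G.EdgeLabeling K) (S : Finset V) : Prop :=
  T.coe.IsTree ∧ (∀ v ∈ S, v ∈ T.verts) ∧ T.IsRainbow c

/-- An edge-coloring `c` of `G` is a `k`-rainbow coloring if for every set `S` of `k` vertices
of `G` there is a rainbow `S`-tree. -/
def IsRainbowColoring {G : SimpleGraph V} {K : Type*} (k : ℕ) (c : G.EdgeLabeling K) : Prop :=
  ∀ S : Finset V, S.card = k → ∃ T : G.Subgraph, T.IsRainbowSteinerTree c S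

/-- The `k`-rainbow index `rx_k(G)`: the least number `t` such that `G` has a `k`-rainbow
coloring with colors from a set of `t` elements. (For a finite connected graph such a `t`
exists, see `exists_isRainbowColoring` and `exists_isRainbowColoring_rainbowIndex`.) -/
noncomputable def rainbowIndex (k : ℕ) (G : SimpleGraph V) : ℕ :=
  sInf {t : ℕ | ∃ c : G.EdgeLabeling (Fin t), IsRainbowColoring k c}

/-- Coloring all edges of a finite connected graph differently gives a `k`-rainbow coloring. -/
theorem exists_isRainbowColoring [Finite V] (k : ℕ) {G : SimpleGraph V} (hG : G.Connected) :
    ∃ t : ℕ, ∃ c : G.EdgeLabeling (Fin t), IsRainbowColoring k c := by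
  obtain ⟨t, ⟨c⟩⟩ := Finite.exists_equiv_fin G.edgeSet
  obtain ⟨F, hF, hT⟩ := hG.exists_isTree_le
  refine ⟨t, (fun e => c e), fun S _ => ⟨toSubgraph F hF, ?_, fun v _ => Set.mem_univ v, ?_⟩⟩
  · let φ : F ≃g (toSubgraph F hF).coe :=
      { toFun := fun v => ⟨v, Set.mem_univ v⟩
        invFun := fun v => v.1
        left_inv := fun _ => rfl
        right_inv := fun _ => rfl
        map_rel_iff' := Iff.rfl }
    exact φ.isTree_iff.mp hT
  · intro e f _ _ h
    exact c.injective h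

/-- For a finite connected graph the minimum that defines `rx_k` is attained. -/
theorem exists_isRainbowColoring_rainbowIndex [Finite V] (k : ℕ) {G : SimpleGraph V}
    (hG : G.Connected) : ∃ c : G.EdgeLabeling (Fin (rainbowIndex k G)), IsRainbowColoring k c :=
  Nat.sInf_mem (s := {t : ℕ | ∃ c : G.EdgeLabeling (Fin t), IsRainbowColoring k c})
    (exists_isRainbowColoring k hG)

/-- The vertices of the chain of cliques: the pairs `⟨i, a⟩`, where `0 ≤ i ≤ m + 1` is the
number of the block and `a` is the label within the block. The two end blocks (`i = 0` and
`i = m + 1`) have `d + 2` vertices, the `m` other blocks have `d + 1` vertices. -/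
abbrev CliqueChainVertex (d m : ℕ) : Type :=
  Σ i : Fin (m + 2), Fin (if i = 0 ∨ i = Fin.last (m + 1) then d + 2 else d + 1)

/-- The chain of cliques: disjoint complete graphs `X_0, …, X_{m+1}`, from each of which the
edge between the vertices labelled `0` and `1` is deleted, and, for `0 ≤ i ≤ m`, an edge
between the vertex labelled `1` of `X_i` and the vertex labelled `0` of `X_{i+1}`. -/
def cliqueChain (d m : ℕ) : SimpleGraph (CliqueChainVertex d m) where
  Adj x y :=
    (x.1 = y.1 ∧ x.2.val ≠ y.2.val ∧ ¬ (x.2.val = 0 ∧ y.2.val = 1) ∧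
      ¬ (x.2.val = 1 ∧ y.2.val = 0)) ∨
    (x.1.val + 1 = y.1.val ∧ x.2.val = 1 ∧ y.2.val = 0) ∨
    (y.1.val + 1 = x.1.val ∧ y.2.val = 1 ∧ x.2.val = 0)
  symm := ⟨by
    rintro x y (⟨h1, h2, h3, h4⟩ | h | h)
    · exact Or.inl ⟨h1.symm, h2.symm, fun h => h4 ⟨h.2, h.1⟩, fun h => h3 ⟨h.2, h.1⟩⟩
    · exact Or.inr (Or.inr h)
    · exact Or.inr (Or.inl h)⟩
  loopless := ⟨by
    rintro x (⟨_, h, _⟩ | ⟨h, _⟩ | ⟨h, _⟩)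
    · exact h rfl
    · omega
    · omega⟩

instance (d m : ℕ) : DecidableRel (cliqueChain d m).Adj := fun x y => by
  unfold cliqueChain
  infer_instance

end SimpleGraph

namespace SimpleGraph

/-! Upper bounds. Let `D` be a connected vertex set. Give the `|D| - 1` edges of a spanning tree of
`D` private colors, and color the other edges so that any three vertices can be joined to `D` by
paths with pairwise disjoint sets of colors. The tree and the three paths then form a connected
rainbow subgraph, and any spanning tree of it is the required one (`rainbowIndex_le_of_attachable`).

Let `N` be the set of vertices at distance one from `D`, and `W` the set of the remaining ones. If
every vertex of `N` has three neighbors in `D ∪ N`, six colors serve `N`: three spoke colors for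
edges to `D` and three inner colors for edges within `N`. Cover `N` by as few disjoint paths as
possible and label the vertices by their positions modulo 3; a vertex of label `i` has a spoke of
color `i`, and the path edge to its successor has color `i`. Inside a path, the three spoke colors
are reached directly, through the successor and through the predecessor, with at most one inner
color each. An end lacks one of these neighbors, but by minimality any further neighbor of it lies
in `D` or inside a path, unless the path closes up to a cycle, which is colored separately; so the
third spoke color costs at most two inner colors. A finite check shows that any three vertices can
choose distinct spoke colors with disjoint inner sets (`exists_end_mid_coloring`,
`exists_disjoint_endInner`).

If each vertex of `W` has two neighbors in `N`, and each vertex of `N` at most one in `W`, then `W`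
is split into pairs with one new color per pair. When both partners occur in a triple, one of them
enters `N` by an edge with an inner color that the three routes avoid. Such a color exists unless
both entry vertices are ends of the same type. The type of an end can be prescribed, provided the
two ends of a path get opposite types; as the union of two matchings is bipartite, the entry
vertices of partners can be given opposite types as well. Hence `rx₃ ≤ |D| + 5 + ⌈|W| / 2⌉`
(`rainbowIndex_le_of_two_layers`).

A suitable `D` comes from minimizing a potential over connected sets. For minimum degree 4 or 5 it
is `3|W| + k|D|` with `k = 5` or `6` (`exists_connected_of_degree`). For minimum degree 3 an edge to
`W` would leave too few neighbors in `D ∪ N`, so a dominating `D` is used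
(`exists_connected_dominating`). The last unit in the constants for degrees 3 and 5 is gained by
starting at a vertex of larger degree, or by parity if the graph is regular of odd degree.

Lower bounds. A rainbow tree through two vertices contains a rainbow path between them, so the index
is at least the diameter; the diameter of the chain of cliques is computed with a height function.
-/

/-- A connected subgraph contains a tree with the same vertices. -/
theorem Subgraph.Connected.exists_isTree_le {V : Type*} {G : SimpleGraph V} {R : G.Subgraph}
    (hR : R.Connected) : ∃ T : G.Subgraph, T ≤ R ∧ T.verts = R.verts ∧ T.coe.IsTree := by
  obtain ⟨F, hF, hT⟩ := hR.coe.exists_isTree_le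
  let T : G.Subgraph :=
    { verts := R.verts
      Adj := fun u v => ∃ (hu : u ∈ R.verts) (hv : v ∈ R.verts), F.Adj ⟨u, hu⟩ ⟨v, hv⟩
      adj_sub := fun ⟨_, _, h⟩ => R.adj_sub (hF h)
      edge_vert := fun ⟨hu, _, _⟩ => hu
      symm := ⟨fun _ _ ⟨hu, hv, h⟩ => ⟨hv, hu, h.symm⟩⟩ }
  refine ⟨T, ⟨le_rfl, fun u v ⟨_, _, h⟩ => hF h⟩, rfl, ?_⟩
  have : T.coe = F := by
    ext u v
    exact ⟨fun ⟨_, _, h⟩ => h, fun h => ⟨u.2, v.2, h⟩⟩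
  rw [this]
  exact hT

/-- The number of edges of a subgraph that is a tree. -/
theorem Subgraph.ncard_edgeSet_of_isTree {V : Type*} [Finite V] {G : SimpleGraph V}
    {T : G.Subgraph} (hT : T.coe.IsTree) : T.edgeSet.ncard + 1 = T.verts.ncard := by
  have h := (isTree_iff_connected_and_card.mp hT).2
  rw [← Subgraph.image_coe_edgeSet_coe, Set.ncard_image_of_injective _
    (Sym2.map.injective Subtype.val_injective)]
  exact h

/-! ### Attaching vertices to a connected set by paths with disjoint colors -/

section Attachment

variable {V K : Type*} [DecidableEq K]

/-- The vertex `v` can be attached to the set `D` by a path with edges outside `D`, the colors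
of which are pairwise distinct elements of `C`. -/
inductive Attachable (G : SimpleGraph V) (D : Finset V) (c : Sym2 V → K) : V → Finset K → Prop
  | base {v : V} {C : Finset K} (h : v ∈ D) : Attachable G D c v C
  | step {v u : V} {C : Finset K} (hv : v ∉ D) (h : G.Adj v u) (hc : c s(v, u) ∈ C)
      (hu : Attachable G D c u (C.erase (c s(v, u)))) : Attachable G D c v C

variable {G : SimpleGraph V} {D : Finset V} {c : Sym2 V → K}

theorem Attachable.mono {v : V} {C : Finset K} (h : Attachable G D c v C) :
    ∀ {C' : Finset K}, C ⊆ C' → Attachable G D c v C' := by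
  induction h with
  | base h => exact fun _ => .base h
  | step hv h hc _ ih => exact fun hC => .step hv h (hC hc) (ih (Finset.erase_subset_erase _ hC))

theorem Attachable.insert {v u : V} {C : Finset K} {x : K} (hv : v ∉ D) (h : G.Adj v u)
    (hx : c s(v, u) = x) (hC : x ∉ C) (hu : Attachable G D c u C) :
    Attachable G D c v (insert x C) := by
  subst hx
  refine .step hv h (Finset.mem_insert_self _ _) ?_
  rwa [Finset.erase_insert hC]

theorem Attachable.map {K' : Type*} [DecidableEq K'] {G' : SimpleGraph V} {c' : Sym2 V → K'}
    (f : K ↪ K') (hG : G ≤ G') (hc : ∀ x y, G.Adj x y → x ∉ D → c' s(x, y) = f (c s(x, y)))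
    {v : V} {C : Finset K} (h : Attachable G D c v C) :
    Attachable G' D c' v (C.map f) := by
  induction h with
  | base h => exact .base h
  | step hv h hcC _ ih =>
    refine .step hv (hG h) ?_ ?_
    · rw [hc _ _ h hv]
      exact Finset.mem_map_of_mem f hcC
    · rw [hc _ _ h hv, ← Finset.map_erase]
      exact ih

theorem Attachable.exists_subgraph {v : V} {C : Finset K} (h : Attachable G D c v C) :
    ∃ R : G.Subgraph, R.Connected ∧ v ∈ R.verts ∧ (∃ d ∈ D, d ∈ R.verts) ∧
      (∀ e ∈ R.edgeSet, c e ∈ C ∧ ∃ x ∈ e, x ∉ D) ∧ Set.InjOn c R.edgeSet := by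
  induction h with
  | @base v C h =>
    exact ⟨G.singletonSubgraph v, Subgraph.singletonSubgraph_connected, by simp, ⟨v, h, by simp⟩,
      by simp, by simp⟩
  | @step v u C hv h hc _ ih =>
    obtain ⟨R, hR, hu, ⟨d, hd, hdR⟩, hRc, hinj⟩ := ih
    refine ⟨G.subgraphOfAdj h ⊔ R, ?_, by simp, ⟨d, hd, by simp [hdR]⟩, ?_, ?_⟩
    · exact Subgraph.connected_sup (Subgraph.subgraphOfAdj_connected h).preconnected
        hR.preconnected ⟨u, by simp [hu]⟩
    · intro e he
      rw [Subgraph.edgeSet_sup, edgeSet_subgraphOfAdj] at he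
      rcases he with rfl | he
      · exact ⟨hc, v, by simp, hv⟩
      · exact ⟨Finset.mem_of_mem_erase (hRc e he).1, (hRc e he).2⟩
    · rw [Subgraph.edgeSet_sup, edgeSet_subgraphOfAdj, Set.singleton_union]
      intro e he f hf hef
      rcases he with rfl | he <;> rcases hf with rfl | hf
      · rfl
      · exact absurd (hRc f hf).1 (by simp [← hef])
      · exact absurd (hRc e he).1 (by simp [hef])
      · exact hinj he hf hef

/-- If the colors of the edges outside the connected set `D` are such that any three vertices can
be attached to `D` by paths with disjoint sets of colors, then adding the edges of a spanning
tree of `D` as further colors gives a 3-rainbow coloring. -/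
theorem rainbowIndex_le_of_attachable [Fintype V] [DecidableEq V] [Fintype K]
    (hD : (G.induce (D : Set V)).Connected)
    (h : ∀ x y z : V, x ≠ y → x ≠ z → y ≠ z → ∃ C₁ C₂ C₃ : Finset K, Disjoint C₁ C₂ ∧
      Disjoint C₁ C₃ ∧ Disjoint C₂ C₃ ∧ Attachable G D c x C₁ ∧ Attachable G D c y C₂ ∧
      Attachable G D c z C₃) :
    rainbowIndex 3 G + 1 ≤ D.card + Fintype.card K := by
  classical
  have hD' : ((⊤ : G.Subgraph).induce (D : Set V)).Connected := connected_induce_iff.mp hD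
  obtain ⟨T, hTle, hTv, hT⟩ := hD'.exists_isTree_le
  have hTD : T.verts = (D : Set V) := by rw [hTv]; rfl
  have hcard := Subgraph.ncard_edgeSet_of_isTree hT
  rw [hTD, Set.ncard_coe_finset] at hcard
  -- Each tree edge is its own color, so tree edges never conflict with each other or with the
  -- colors in `K`.
  let c' : Sym2 V → T.edgeSet ⊕ K := fun e =>
    if he : e ∈ T.edgeSet then .inl ⟨e, he⟩ else .inr (c e)
  have hTedge : ∀ e ∈ T.edgeSet, ∀ x ∈ e, x ∈ D := by
    intro e he x hx
    have := T.mem_verts_of_mem_edge he hx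
    rw [hTD] at this
    exact this
  have hmain : IsRainbowColoring 3 (fun e : G.edgeSet => c' e) := by
    intro S hS
    obtain ⟨x, y, z, hxy, hxz, hyz, rfl⟩ := Finset.card_eq_three.mp hS
    obtain ⟨C₁, C₂, C₃, h12, h13, h23, hx, hy, hz⟩ := h x y z hxy hxz hyz
    obtain ⟨R₁, hR₁, hx₁, ⟨d₁, hd₁, hd₁R⟩, hc₁, hi₁⟩ := hx.exists_subgraph
    obtain ⟨R₂, hR₂, hx₂, ⟨d₂, hd₂, hd₂R⟩, hc₂, hi₂⟩ := hy.exists_subgraph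
    obtain ⟨R₃, hR₃, hx₃, ⟨d₃, hd₃, hd₃R⟩, hc₃, hi₃⟩ := hz.exists_subgraph
    have mT : ∀ {d}, d ∈ D → d ∈ T.verts := fun hd => by rw [hTD]; exact hd
    let R : G.Subgraph := ((T ⊔ R₁) ⊔ R₂) ⊔ R₃
    have hTc : T.Connected := ⟨hT.1⟩
    have hR : R.Connected := by
      refine Subgraph.connected_sup (Subgraph.connected_sup (Subgraph.connected_sup
        hTc.preconnected hR₁.preconnected ⟨d₁, mT hd₁, hd₁R⟩).preconnected
          hR₂.preconnected ⟨d₂, ?_, hd₂R⟩).preconnected hR₃.preconnected ⟨d₃, ?_, hd₃R⟩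
      · exact Or.inl (mT hd₂)
      · exact Or.inl (Or.inl (mT hd₃))
    obtain ⟨F, hFle, hFv, hF⟩ := hR.exists_isTree_le
    refine ⟨F, hF, ?_, ?_⟩
    · intro v hv
      rw [hFv]
      simp only [Finset.mem_insert, Finset.mem_singleton] at hv
      rcases hv with rfl | rfl | rfl
      · exact Or.inl (Or.inl (Or.inr hx₁))
      · exact Or.inl (Or.inr hx₂)
      · exact Or.inr hx₃
    · have hcol : ∀ e, (∃ x ∈ e, x ∉ D) → c' e = .inr (c e) := by
        rintro e ⟨x, hx, hxD⟩
        exact dif_neg fun he => hxD (hTedge e he x hx)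
      have key : Set.InjOn c' R.edgeSet := by
        have e1 : R.edgeSet = T.edgeSet ∪ R₁.edgeSet ∪ R₂.edgeSet ∪ R₃.edgeSet := by
          simp [R, Subgraph.edgeSet_sup]
        have hT' : ∀ e ∈ T.edgeSet, ∃ he : e ∈ T.edgeSet, c' e = .inl ⟨e, he⟩ :=
          fun e he => ⟨he, dif_pos he⟩
        rw [e1]
        intro e he f hf hef
        have hcl : ∀ e ∈ T.edgeSet ∪ R₁.edgeSet ∪ R₂.edgeSet ∪ R₃.edgeSet,
            (∃ he : e ∈ T.edgeSet, c' e = .inl ⟨e, he⟩) ∨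
            (e ∈ R₁.edgeSet ∧ c e ∈ C₁ ∧ c' e = .inr (c e)) ∨
            (e ∈ R₂.edgeSet ∧ c e ∈ C₂ ∧ c' e = .inr (c e)) ∨
            (e ∈ R₃.edgeSet ∧ c e ∈ C₃ ∧ c' e = .inr (c e)) := by
          rintro e (((he | he) | he) | he)
          · exact Or.inl (hT' e he)
          · exact Or.inr (Or.inl ⟨he, (hc₁ e he).1, hcol e (hc₁ e he).2⟩)
          · exact Or.inr (Or.inr (Or.inl ⟨he, (hc₂ e he).1, hcol e (hc₂ e he).2⟩))
          · exact Or.inr (Or.inr (Or.inr ⟨he, (hc₃ e he).1, hcol e (hc₃ e he).2⟩))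
        have d12 := Finset.disjoint_left.mp h12
        have d13 := Finset.disjoint_left.mp h13
        have d23 := Finset.disjoint_left.mp h23
        rcases hcl e he with ⟨h1, h2⟩ | ⟨h1, h2, h3⟩ | ⟨h1, h2, h3⟩ | ⟨h1, h2, h3⟩ <;>
        rcases hcl f hf with ⟨g1, g2⟩ | ⟨g1, g2, g3⟩ | ⟨g1, g2, g3⟩ | ⟨g1, g2, g3⟩ <;>
        (first | rw [h2, g2] at hef | rw [h2, g3] at hef | rw [h3, g2] at hef | rw [h3, g3] at hef) <;>
        first
        | exact congrArg Subtype.val (Sum.inl_injective hef)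
        | exact absurd hef Sum.inl_ne_inr
        | exact absurd hef Sum.inr_ne_inl
        | (replace hef := Sum.inr_injective hef
           first
           | exact hi₁ h1 g1 hef
           | exact hi₂ h1 g1 hef
           | exact hi₃ h1 g1 hef
           | (rw [hef] at h2
              first
              | exact absurd g2 (d12 h2)
              | exact absurd h2 (d12 g2)
              | exact absurd g2 (d13 h2)
              | exact absurd h2 (d13 g2)
              | exact absurd g2 (d23 h2)
              | exact absurd h2 (d23 g2)))
      intro e f he hf hef
      exact Subtype.ext (key (Subgraph.edgeSet_mono hFle he) (Subgraph.edgeSet_mono hFle hf) hef)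
  have hle : rainbowIndex 3 G ≤ Fintype.card (T.edgeSet ⊕ K) := by
    let φ := Fintype.equivFin (T.edgeSet ⊕ K)
    refine Nat.sInf_le ⟨fun e => φ (c' e), fun S hS => ?_⟩
    obtain ⟨F, h1, h2, h3⟩ := hmain S hS
    exact ⟨F, h1, h2, fun e f he hf hef => h3 e f he hf (φ.injective hef)⟩
  rw [Fintype.card_sum, ← Nat.card_eq_fintype_card (α := T.edgeSet), Nat.card_coe_set_eq] at hle
  omega

end Attachment

/-! ### Finite color patterns and bipartite unions of matchings -/

/-- The sets of inner colors on the paths that attach a vertex of label `i` at an end of a path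
system, for the three possible colors `j` of the last edge of the path. -/
def endInner (b : Bool) (i j : Fin 3) : Finset (Fin 3) :=
  if j = i then ∅
  else if j = i + 1 then (if b then {i} else {i, i + 1})
  else (if b then {i + 1, i + 2} else {i + 2})

/-- The sets of inner colors on the paths that attach a vertex of label `i` inside a path system:
for the two other labels `j`, there is just one inner color, and these two are different. -/
def midInner (g i j : Fin 3) : Finset (Fin 3) :=
  if j = i then ∅
  else if j = i + 1 then (if g = 2 then {i + 1} else {i})
  else (if g = 1 then {i + 1} else {i + 2})

theorem exists_disjoint_endInner : ∀ (b₁ b₂ b₃ : Bool) (i₁ i₂ i₃ : Fin 3), ∃ j₁ j₂ j₃ : Fin 3,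
    j₁ ≠ j₂ ∧ j₁ ≠ j₃ ∧ j₂ ≠ j₃ ∧ Disjoint (endInner b₁ i₁ j₁) (endInner b₂ i₂ j₂) ∧
      Disjoint (endInner b₁ i₁ j₁) (endInner b₃ i₃ j₃) ∧
      Disjoint (endInner b₂ i₂ j₂) (endInner b₃ i₃ j₃) := by
  decide

/-- The spare inner color `y` is chosen before the third vertex is known: it will color a fixed edge
of the graph, whereas the third vertex varies with the triple. The next theorem has the same order
of quantifiers for the same reason. -/
theorem exists_disjoint_midInner : ∀ (g i₁ : Fin 3) (b₂ : Bool) (i₂ : Fin 3), ∃ y : Fin 3,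
    ∀ (b₃ : Bool) (i₃ : Fin 3), ∃ j₁ j₂ j₃ : Fin 3,
    j₁ ≠ j₂ ∧ j₁ ≠ j₃ ∧ j₂ ≠ j₃ ∧ Disjoint (midInner g i₁ j₁) (endInner b₂ i₂ j₂) ∧
      Disjoint (midInner g i₁ j₁) (endInner b₃ i₃ j₃) ∧
      Disjoint (endInner b₂ i₂ j₂) (endInner b₃ i₃ j₃) ∧
      y ∉ midInner g i₁ j₁ ∧ y ∉ endInner b₂ i₂ j₂ ∧ y ∉ endInner b₃ i₃ j₃ := by
  decide

theorem exists_disjoint_endInner_true_false : ∀ (i₁ i₂ : Fin 3), ∃ y : Fin 3,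
    ∀ (b₃ : Bool) (i₃ : Fin 3), ∃ j₁ j₂ j₃ : Fin 3,
    j₁ ≠ j₂ ∧ j₁ ≠ j₃ ∧ j₂ ≠ j₃ ∧ Disjoint (endInner true i₁ j₁) (endInner false i₂ j₂) ∧
      Disjoint (endInner true i₁ j₁) (endInner b₃ i₃ j₃) ∧
      Disjoint (endInner false i₂ j₂) (endInner b₃ i₃ j₃) ∧
      y ∉ endInner true i₁ j₁ ∧ y ∉ endInner false i₂ j₂ ∧ y ∉ endInner b₃ i₃ j₃ := by
  decide

/-- An inner vertex of a path is at least as flexible as some kind of end, so triples need only be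
checked for ends. -/
theorem midInner_subset_endInner : ∀ g i : Fin 3, ∃ b, ∀ j, midInner g i j ⊆ endInner b i j := by
  decide

/-- The union of two matchings, one of them given by an involution and the other one by a list of
disjoint pairs, is bipartite. -/
theorem exists_bool_coloring_of_involutive {V : Type*} (ps : List (V × V)) :
    ∀ f : V → V, Function.Involutive f → (∀ x ∈ ps, x.1 ≠ x.2) →
    ps.Pairwise (fun x y => x.1 ≠ y.1 ∧ x.1 ≠ y.2 ∧ x.2 ≠ y.1 ∧ x.2 ≠ y.2) →
    ∃ κ : V → Bool, (∀ v, f v ≠ v → κ (f v) ≠ κ v) ∧ ∀ x ∈ ps, κ x.1 ≠ κ x.2 := by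
  classical
  induction ps with
  | nil =>
    intro f hf _ _
    -- For an involution alone, a well-order decides: exactly one of two distinct mates precedes the
    -- other.
    refine ⟨fun v => decide (WellOrderingRel v (f v)), fun v hv h => ?_, by simp⟩
    rw [decide_eq_decide, hf v] at h
    rcases trichotomous_of WellOrderingRel v (f v) with h1 | h1 | h1
    · exact asymm_of WellOrderingRel h1 (h.mpr h1)
    · exact hv h1.symm
    · exact asymm_of WellOrderingRel h1 (h.mp h1)
  | cons x ps ih =>
    obtain ⟨p, q⟩ := x
    intro f hf hne hps
    rw [List.pairwise_cons] at hps
    obtain ⟨hx, hps⟩ := hps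
    have hpq : p ≠ q := hne (p, q) (by simp)
    have hff : ∀ v, f (f v) = v := hf
    -- Cuts out `p` and `q` and makes their former mates, if both exist, mates of each other. The
    -- path `f p, p, q, f q` of three edges is thus replaced by one edge, which keeps the parity.
    let f' : V → V := fun v => if v = p ∨ v = q then v else
      if f v = p then (if f q = q then v else f q) else
      if f v = q then (if f p = p then v else f p) else f v
    have hf' : Function.Involutive f' := by
      intro v
      have h1 := hff v
      have h2 := hff p
      have h3 := hff q
      simp only [f']
      grind
    obtain ⟨κ, hκ, hκps⟩ := ih f' hf' (fun x hx => hne x (by simp [hx])) hps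
    -- The color of `p` is forced by `f p`, or else by `f q` through `q`; if neither constrains it,
    -- `true` is an arbitrary choice.
    let κp : Bool := if f p = q then true else
      if f p = p then (if f q = q then true else κ (f q)) else !κ (f p)
    let κ' : V → Bool := fun v => if v = p then κp else if v = q then !κp else κ v
    refine ⟨κ', ?_, ?_⟩
    · have hkp : f p ≠ p → f p ≠ q → κp = !κ (f p) := fun h1 h2 => by simp [κp, h1, h2]
      have hkq : f q ≠ q → f q ≠ p → κp = κ (f q) := by
        intro h1 h2
        have h3 : f p ≠ q := fun h => h2 (by rw [← h, hff])
        by_cases h4 : f p = p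
        · simp [κp, h4, h1, hpq]
        · have h5 := hκ (f p)
          have h6 : f' (f p) = f q := by
            have : f p ≠ p ∧ f p ≠ q := ⟨h4, h3⟩
            simp only [f', hff, this, false_or, if_false, if_true, h1]
          rw [h6] at h5
          have h7 : f q ≠ f p := fun h => hpq (hf.injective h).symm
          have h8 := h5 h7
          simp only [κp, h3, h4, if_false]
          revert h8
          cases κ (f q) <;> cases κ (f p) <;> simp
      have key : ∀ v, f v ≠ v → v ≠ p → v ≠ q → κ' (f v) ≠ κ' v := by
        intro v hv hvp hvq
        have e1 : κ' v = κ v := by simp [κ', hvp, hvq]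
        rw [e1]
        by_cases h1 : f v = p
        · have h2 : f p = v := by rw [← h1, hff]
          have := hkp (by rwa [h2]) (by rwa [h2])
          simp [κ', h1, this, h2]
        · by_cases h2 : f v = q
          · have h3 : f q = v := by rw [← h2, hff]
            have := hkq (by rwa [h3]) (by rwa [h3])
            simp [κ', h2, hpq.symm, this, h3]
          · have h3 := hκ v
            have h4 : f' v = f v := by simp [f', hvp, hvq, h1, h2]
            rw [h4] at h3
            simpa [κ', h1, h2] using h3 hv
      intro v hv
      by_cases hvp : v = p
      · by_cases h1 : f p = q
        · subst hvp
          simp [κ', h1, hpq.symm]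
        · have h2 : f p ≠ p := hvp ▸ hv
          have := key (f p) (by rw [hff]; exact h2.symm) h2 h1
          rw [hff] at this
          rw [hvp]
          exact this.symm
      · by_cases hvq : v = q
        · by_cases h1 : f q = p
          · subst hvq
            simp [κ', h1, hpq.symm]
          · have h2 : f q ≠ q := hvq ▸ hv
            have := key (f q) (by rw [hff]; exact h2.symm) h1 h2
            rw [hff] at this
            rw [hvq]
            exact this.symm
        · exact key v hv hvp hvq
    · intro x hx'
      rw [List.mem_cons] at hx'
      rcases hx' with rfl | hx'
      · simp [κ', hpq.symm]
      · have h1 := hx x hx'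
        have h2 := hκps x hx'
        simp only [κ']
        grind

/-! ### Minimum path covers -/

section PathCover

variable {V : Type*}

/-- A partition of the set `N` into the vertex sets of paths, given as lists. -/
structure IsPathCover (G : SimpleGraph V) (N : Finset V) (L : List (List V)) : Prop where
  nodup : L.flatten.Nodup
  mem_iff : ∀ v, v ∈ L.flatten ↔ v ∈ N
  ne_nil : ∀ l ∈ L, l ≠ []
  chain : ∀ l ∈ L, l.IsChain G.Adj

/-- The vertices of the list `l` can be rearranged to a path that ends in `a`. -/
def Endable (G : SimpleGraph V) (l : List V) (a : V) : Prop :=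
  ∃ t, (t ++ [a]).Perm l ∧ (t ++ [a]).IsChain G.Adj

variable {G : SimpleGraph V} {N : Finset V}

theorem isChain_adj_reverse {l : List V} : l.reverse.IsChain G.Adj ↔ l.IsChain G.Adj := by
  rw [List.isChain_reverse]
  have : (fun a b => G.Adj b a) = G.Adj := by
    ext a b
    exact G.adj_comm b a
  rw [this]

theorem Endable.perm {l l' : List V} {a : V} (h : Endable G l a) (hl : l.Perm l') :
    Endable G l' a :=
  let ⟨t, h1, h2⟩ := h
  ⟨t, h1.trans hl, h2⟩

/-- A path can be turned so as to end in `a` if `a` is its last or its first vertex, or if the path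
closes up to a cycle, which can be cut next to `a`. -/
theorem endable_append {t s : List V} {a : V} (h : (t ++ a :: s).IsChain G.Adj)
    (hs : s = [] ∨ t = [] ∨ ∃ x y, t.head? = some x ∧ s.getLast? = some y ∧ G.Adj x y) :
    Endable G (t ++ a :: s) a := by
  rcases hs with rfl | rfl | ⟨x, y, hx, hy, hxy⟩
  · exact ⟨t, .refl _, h⟩
  · refine ⟨s.reverse, ?_, ?_⟩
    · rw [← List.reverse_cons]
      exact List.reverse_perm _
    · rw [← List.reverse_cons]
      exact isChain_adj_reverse.mpr h
  · refine ⟨s ++ t, ?_, ?_⟩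
    · calc s ++ t ++ [a] = s ++ (t ++ [a]) := by simp
        _ |>.Perm ((t ++ [a]) ++ s) := List.perm_append_comm
        _ = t ++ a :: s := by simp
    · rw [List.append_assoc]
      have h' : (t ++ [a] ++ s).IsChain G.Adj := by simpa using h
      rw [List.isChain_append] at h' ⊢
      refine ⟨h'.2.1, h'.1, ?_⟩
      intro p hp q hq
      have ht : t ≠ [] := by
        rintro rfl
        simp at hx
      rw [hy] at hp
      rw [List.head?_append_of_ne_nil _ ht, hx] at hq
      simp only [Option.mem_def, Option.some.injEq] at hp hq
      subst hp hq
      exact hxy.symm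

theorem IsPathCover.exists_min [DecidableEq V] (G : SimpleGraph V) (N : Finset V) :
    ∃ L, IsPathCover G N L ∧ ∀ L', IsPathCover G N L' → L.length ≤ L'.length := by
  classical
  have h0 : IsPathCover G N (N.toList.map fun v => [v]) := by
    have : (N.toList.map fun v => [v]).flatten = N.toList := by
      induction N.toList <;> simp_all
    refine ⟨?_, ?_, ?_, ?_⟩
    · rw [this]
      exact N.nodup_toList
    · simp [this]
    · simp
    · simp
  have hex : ∃ n, ∃ L, IsPathCover G N L ∧ L.length = n := ⟨_, _, h0, rfl⟩
  obtain ⟨L, hL, hlen⟩ := Nat.find_spec hex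
  exact ⟨L, hL, fun L' hL' => hlen ▸ Nat.find_min' hex ⟨L', hL', rfl⟩⟩

/-- Otherwise the two paths could be joined by the edge `ab`, and the cover would have one path
less. -/
theorem IsPathCover.eq_of_adj [DecidableEq V] {L : List (List V)} (hL : IsPathCover G N L)
    (hmin : ∀ L', IsPathCover G N L' → L.length ≤ L'.length) {l₁ l₂ : List V} (h₁ : l₁ ∈ L)
    (h₂ : l₂ ∈ L) {a b : V} (ha : Endable G l₁ a) (hb : Endable G l₂ b) (hab : G.Adj a b) :
    l₁ = l₂ := by
  by_contra hne
  obtain ⟨t, ht, htc⟩ := ha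
  obtain ⟨s, hs, hsc⟩ := hb
  have p1 : L.Perm (l₁ :: L.erase l₁) := List.perm_cons_erase h₁
  have h₂' : l₂ ∈ L.erase l₁ := (List.mem_erase_of_ne (Ne.symm hne)).mpr h₂
  have p2 : (L.erase l₁).Perm (l₂ :: (L.erase l₁).erase l₂) := List.perm_cons_erase h₂'
  set M := (L.erase l₁).erase l₂
  have p3 : L.Perm (l₁ :: l₂ :: M) := p1.trans (p2.cons _)
  have hs' : (s ++ [b]).reverse.Perm l₂ := (List.reverse_perm _).trans hs
  let l := (t ++ [a]) ++ (s ++ [b]).reverse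
  have p4 : (l :: M).flatten.Perm L.flatten := by
    refine List.Perm.trans ?_ p3.flatten.symm
    simp only [List.flatten_cons, l]
    rw [← List.append_assoc]
    exact (ht.append hs').append_right _
  have hM : ∀ x ∈ M, x ∈ L := fun x hx => List.mem_of_mem_erase (List.mem_of_mem_erase hx)
  have hcov : IsPathCover G N (l :: M) := by
    refine ⟨p4.nodup_iff.mpr hL.nodup, fun v => p4.mem_iff.trans (hL.mem_iff v), ?_, ?_⟩
    · intro x hx
      rcases List.mem_cons.mp hx with rfl | hx
      · simp [l]
      · exact hL.ne_nil x (hM x hx)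
    · intro x hx
      rcases List.mem_cons.mp hx with rfl | hx
      · refine List.isChain_append.mpr ⟨htc, isChain_adj_reverse.mpr hsc, ?_⟩
        simpa using hab
      · exact hL.chain x (hM x hx)
  have h5 := hmin _ hcov
  rw [p3.length_eq] at h5
  simp at h5

/-- A system of disjoint paths: `L v` is the path that contains `v`, and `pos v` is the position
of `v` on it. -/
structure IsPathSystem (G : SimpleGraph V) (N : Finset V) (L : V → List V) (pos : V → ℕ) :
    Prop where
  getElem?_pos : ∀ v ∈ N, (L v)[pos v]? = some v
  eq_of_getElem? : ∀ v ∈ N, ∀ i u, (L v)[i]? = some u → u ∈ N ∧ L u = L v ∧ pos u = i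
  chain : ∀ v ∈ N, (L v).IsChain G.Adj
  eq_of_adj : ∀ u ∈ N, ∀ v ∈ N, G.Adj u v → Endable G (L u) u → Endable G (L v) v → L u = L v

theorem exists_isPathSystem (G : SimpleGraph V) (N : Finset V) :
    ∃ L pos, IsPathSystem G N L pos := by
  classical
  obtain ⟨L, hL, hmin⟩ := IsPathCover.exists_min G N
  have hex : ∀ v ∈ N, ∃ l ∈ L, ∃ i : ℕ, l[i]? = some v := by
    intro v hv
    obtain ⟨l, hl, hvl⟩ := List.mem_flatten.mp ((hL.mem_iff v).mpr hv)
    exact ⟨l, hl, List.mem_iff_getElem?.mp hvl⟩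
  obtain ⟨hnd, hpw⟩ := List.nodup_flatten.mp hL.nodup
  have huniq : ∀ l l' : List V, l ∈ L → l' ∈ L → ∀ (i i' : ℕ) (v : V), l[i]? = some v →
      l'[i']? = some v → l = l' ∧ i = i' := by
    intro l l' hl hl' i i' v h h'
    have hll : l = l' := by
      by_contra hne
      have : Std.Symm (α := List V) List.Disjoint := ⟨fun _ _ h => h.symm⟩
      exact hpw.forall hl hl' hne (List.mem_of_getElem? h) (List.mem_of_getElem? h')
    subst hll
    refine ⟨rfl, ?_⟩
    exact (List.getElem?_inj (List.getElem?_eq_some_iff.mp h).1 (hnd l hl)).mp (h.trans h'.symm)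
  let f : V → List V := fun v => if hv : v ∈ N then (hex v hv).choose else []
  let pos : V → ℕ := fun v => if hv : v ∈ N then (hex v hv).choose_spec.2.choose else 0
  have hf : ∀ v ∈ N, f v ∈ L ∧ (f v)[pos v]? = some v := by
    intro v hv
    simp only [f, pos, hv, dif_pos]
    exact ⟨(hex v hv).choose_spec.1, (hex v hv).choose_spec.2.choose_spec⟩
  refine ⟨f, pos, fun v hv => (hf v hv).2, ?_, fun v hv => hL.chain _ (hf v hv).1, ?_⟩
  · intro v hv i u hu
    have huN : u ∈ N := (hL.mem_iff u).mp
      (List.mem_flatten.mpr ⟨f v, (hf v hv).1, List.mem_iff_getElem?.mpr ⟨i, hu⟩⟩)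
    exact ⟨huN, huniq _ _ (hf u huN).1 (hf v hv).1 _ _ u (hf u huN).2 hu⟩
  · intro u hu v hv huv eu ev
    exact hL.eq_of_adj hmin (hf u hu).1 (hf v hv).1 eu ev huv

end PathCover

/-! ### Ends and inner vertices of a path system, and the kinds of edges to be colored -/

section PathSystem

variable {V : Type*} {G : SimpleGraph V} {N : Finset V} {L : V → List V} {pos : V → ℕ}

namespace IsPathSystem

theorem pos_lt (h : IsPathSystem G N L pos) {v : V} (hv : v ∈ N) : pos v < (L v).length :=
  (List.getElem?_eq_some_iff.mp (h.getElem?_pos v hv)).1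

theorem exists_pos_eq (h : IsPathSystem G N L pos) {v : V} (hv : v ∈ N) {i : ℕ}
    (hi : i < (L v).length) : ∃ u ∈ N, L u = L v ∧ pos u = i :=
  ⟨_, h.eq_of_getElem? v hv i _ (List.getElem?_eq_getElem hi)⟩

theorem injOn (h : IsPathSystem G N L pos) {u v : V} (hu : u ∈ N) (hv : v ∈ N)
    (hL : L u = L v) (hp : pos u = pos v) : u = v := by
  have h1 := h.getElem?_pos u hu
  rw [hL, hp, h.getElem?_pos v hv] at h1
  exact (Option.some.inj h1).symm

theorem adj_succ (h : IsPathSystem G N L pos) {u v : V} (hu : u ∈ N) (hv : v ∈ N)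
    (hL : L u = L v) (hp : pos v = pos u + 1) : G.Adj u v := by
  have h1 := h.getElem?_pos u hu
  have h2 := h.getElem?_pos v hv
  rw [hL] at h1
  rw [hp] at h2
  obtain ⟨l1, e1⟩ := List.getElem?_eq_some_iff.mp h1
  obtain ⟨l2, e2⟩ := List.getElem?_eq_some_iff.mp h2
  have := List.isChain_iff_getElem.mp (h.chain v hv) (pos u) l2
  rwa [e1, e2] at this

theorem eq_take_append_drop (h : IsPathSystem G N L pos) {v : V} (hv : v ∈ N) :
    L v = (L v).take (pos v) ++ v :: (L v).drop (pos v + 1) := by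
  conv_lhs => rw [← List.take_append_drop (pos v) (L v)]
  rw [List.drop_eq_getElem_cons (h.pos_lt hv)]
  have := (List.getElem?_eq_some_iff.mp (h.getElem?_pos v hv)).2
  rw [this]

theorem endable_of_end (h : IsPathSystem G N L pos) {v : V} (hv : v ∈ N)
    (hp : pos v = 0 ∨ pos v + 1 = (L v).length) : Endable G (L v) v := by
  rw [h.eq_take_append_drop hv]
  refine endable_append (by rw [← h.eq_take_append_drop hv]; exact h.chain v hv) ?_
  rcases hp with hp | hp
  · exact Or.inr (Or.inl (by simp [hp]))
  · exact Or.inl (by simp [hp])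

theorem endable_of_adj (h : IsPathSystem G N L pos) {v x y : V} (hv : v ∈ N) (hx : x ∈ N)
    (hy : y ∈ N) (hxL : L x = L v) (hyL : L y = L v) (hx0 : pos x = 0)
    (hyl : pos y + 1 = (L v).length) (hxy : G.Adj x y) : Endable G (L v) v := by
  by_cases h1 : pos v = 0 ∨ pos v + 1 = (L v).length
  · exact h.endable_of_end hv h1
  push Not at h1
  have h2 := h.pos_lt hv
  rw [h.eq_take_append_drop hv]
  refine endable_append (by rw [← h.eq_take_append_drop hv]; exact h.chain v hv) ?_
  refine Or.inr (Or.inr ⟨x, y, ?_, ?_, hxy⟩)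
  · have := h.getElem?_pos x hx
    rw [hxL, hx0] at this
    rw [List.head?_take, if_neg h1.1, List.head?_eq_getElem?, this]
  · have := h.getElem?_pos y hy
    rw [hyL] at this
    rw [List.getLast?_drop, if_neg (by omega), List.getLast?_eq_getElem?, ← hyl]
    exact this

/-- Reversing some of the paths. -/
theorem reverse (h : IsPathSystem G N L pos) (p : List V → Prop) [DecidablePred p] :
    IsPathSystem G N (fun v => if p (L v) then (L v).reverse else L v)
      (fun v => if p (L v) then (L v).length - 1 - pos v else pos v) := by
  refine ⟨?_, ?_, ?_, ?_⟩
  · intro v hv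
    have h1 := h.pos_lt hv
    have h2 := h.getElem?_pos v hv
    split_ifs
    · rw [List.getElem?_reverse (by omega), ← h2]
      congr 1
      omega
    · exact h2
  · intro v hv i u hu
    split_ifs at hu with hp
    · have hi : i < (L v).length := by
        by_contra hi
        rw [List.getElem?_eq_none (by simpa using hi)] at hu
        cases hu
      rw [List.getElem?_reverse hi] at hu
      obtain ⟨h1, h2, h3⟩ := h.eq_of_getElem? v hv _ u hu
      rw [h2, if_pos hp, if_pos hp]
      exact ⟨h1, rfl, by omega⟩
    · obtain ⟨h1, h2, h3⟩ := h.eq_of_getElem? v hv _ u hu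
      rw [h2, if_neg hp, if_neg hp]
      exact ⟨h1, rfl, h3⟩
  · intro v hv
    split_ifs
    · exact isChain_adj_reverse.mpr (h.chain v hv)
    · exact h.chain v hv
  · have key : ∀ u, (if p (L u) then (L u).reverse else L u).Perm (L u) := by
      intro u
      split_ifs
      · exact List.reverse_perm _
      · exact .refl _
    intro u hu v hv huv eu ev
    rw [h.eq_of_adj u hu v hv huv (eu.perm (key u)) (ev.perm (key v))]

end IsPathSystem

/-- The path through `v` closes up to a cycle. -/
def IsCyclicAt (G : SimpleGraph V) (N : Finset V) (L : V → List V) (pos : V → ℕ) (v : V) : Prop :=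
  3 ≤ (L v).length ∧ ∃ x ∈ N, ∃ y ∈ N, L x = L v ∧ L y = L v ∧ pos x = 0 ∧
    pos y + 1 = (L v).length ∧ G.Adj x y

theorem isCyclicAt_congr {u v : V} (h : L u = L v) :
    IsCyclicAt G N L pos u ↔ IsCyclicAt G N L pos v := by
  unfold IsCyclicAt
  rw [h]

/-- `v` is an end of a path that does not close up to a cycle. -/
def IsFreeEnd (G : SimpleGraph V) (N : Finset V) (L : V → List V) (pos : V → ℕ) (v : V) : Prop :=
  v ∈ N ∧ ¬ IsCyclicAt G N L pos v ∧ (pos v = 0 ∨ pos v + 1 = (L v).length)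

/-- `v` is an inner vertex of a path that does not close up to a cycle. -/
def IsInterior (G : SimpleGraph V) (N : Finset V) (L : V → List V) (pos : V → ℕ) (v : V) : Prop :=
  v ∈ N ∧ ¬ IsCyclicAt G N L pos v ∧ 0 < pos v ∧ pos v + 1 < (L v).length

/-- `u` and `v` are consecutive on a path. -/
def IsConsecutive (L : V → List V) (pos : V → ℕ) (u v : V) : Prop :=
  L u = L v ∧ (pos v = pos u + 1 ∨ pos u = pos v + 1)

/-- This is where minimality of the cover is used. Every vertex of a cyclic path can serve as an
end, so a neighbor of a free end that is not an inner vertex of an open path lies on the same path.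
It is then the opposite end, and the edge would close the path to a cycle unless the two are
consecutive. -/
theorem IsPathSystem.isInterior_of_adj (h : IsPathSystem G N L pos) {u v : V}
    (hu : IsFreeEnd G N L pos u) (hv : v ∈ N) (huv : G.Adj u v)
    (hcons : ¬ IsConsecutive L pos u v) : IsInterior G N L pos v := by
  obtain ⟨huN, huc, hue⟩ := hu
  have eu := h.endable_of_end huN hue
  by_contra hint
  have ev : Endable G (L v) v := by
    by_cases hvc : IsCyclicAt G N L pos v
    · obtain ⟨_, x, hx, y, hy, h1, h2, h3, h4, h5⟩ := hvc
      exact h.endable_of_adj hv hx hy h1 h2 h3 h4 h5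
    · refine h.endable_of_end hv ?_
      have := h.pos_lt hv
      by_contra h2
      exact hint ⟨hv, hvc, by omega, by omega⟩
  have hL := h.eq_of_adj u huN v hv huv eu ev
  have hne : pos u ≠ pos v := fun hp => huv.ne (h.injOn huN hv hL hp)
  have hvc : ¬ IsCyclicAt G N L pos v := by rwa [← isCyclicAt_congr hL]
  have h1 := h.pos_lt hv
  have h2 := h.pos_lt huN
  have hlen : (L u).length = (L v).length := by rw [hL]
  have hve : pos v = 0 ∨ pos v + 1 = (L v).length := by
    by_contra h2
    exact hint ⟨hv, hvc, by omega, by omega⟩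
  have h3 : 3 ≤ (L v).length := by
    by_contra h3
    exact hcons ⟨hL, by omega⟩
  apply hvc
  rcases hve with hve | hve
  · exact ⟨h3, v, hv, u, huN, rfl, hL, hve, by omega, huv.symm⟩
  · exact ⟨h3, u, huN, v, hv, hL, rfl, by omega, hve, huv⟩

/-- Colorings of edges by means of an orientation. -/
theorem exists_sym2_coloring {K : Type*} [Nonempty K] (own : V → V → Prop) (f : V → V → K)
    (hown : ∀ u v, own u v → ¬ own v u) :
    ∃ c : Sym2 V → K, ∀ u v, own u v → c s(u, v) = f u v := by
  classical
  refine ⟨fun e => if h : ∃ x : V × V, own x.1 x.2 ∧ s(x.1, x.2) = e then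
    f h.choose.1 h.choose.2 else Classical.arbitrary K, fun u v huv => ?_⟩
  have h : ∃ x : V × V, own x.1 x.2 ∧ s(x.1, x.2) = s(u, v) := ⟨(u, v), huv, rfl⟩
  dsimp only
  rw [dif_pos h]
  obtain ⟨h1, h2⟩ := h.choose_spec
  rcases Sym2.eq_iff.mp h2 with ⟨h3, h4⟩ | ⟨h3, h4⟩
  · rw [h3, h4]
  · rw [h3, h4] at h1
    exact absurd h1 (hown u v huv)

/-- The four kinds of edges (spokes, path edges, closing edges, and edges from free ends to inner
vertices) do not overlap, and each comes with an orientation. The colors can therefore be prescribed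
independently as functions of ordered pairs. -/
theorem exists_layer_coloring {K : Type*} [Nonempty K] {D : Finset V} (hDN : ∀ v ∈ N, v ∉ D)
    (spoke : V → V → K) (edge closing : V → K) (ext : V → V → K) :
    ∃ c : Sym2 V → K, (∀ v ∈ N, ∀ d ∈ D, c s(v, d) = spoke v d) ∧
      (∀ u ∈ N, ∀ v ∈ N, L u = L v → pos v = pos u + 1 → c s(u, v) = edge u) ∧
      (∀ u ∈ N, ∀ v ∈ N, L u = L v → pos v = 0 → pos u + 1 = (L v).length →
        3 ≤ (L v).length → c s(u, v) = closing u) ∧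
      ∀ u v, IsFreeEnd G N L pos u → IsInterior G N L pos v → ¬ IsConsecutive L pos u v →
        c s(u, v) = ext u v := by
  classical
  let P1 : V → V → Prop := fun u v => u ∈ N ∧ v ∈ D
  let P2 : V → V → Prop := fun u v => u ∈ N ∧ v ∈ N ∧ L u = L v ∧ pos v = pos u + 1
  let P3 : V → V → Prop := fun u v => u ∈ N ∧ v ∈ N ∧ L u = L v ∧ pos v = 0 ∧
    pos u + 1 = (L v).length ∧ 3 ≤ (L v).length
  let P4 : V → V → Prop := fun u v => IsFreeEnd G N L pos u ∧ IsInterior G N L pos v ∧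
    ¬ IsConsecutive L pos u v
  obtain ⟨c, hc⟩ := exists_sym2_coloring (fun u v => P1 u v ∨ P2 u v ∨ P3 u v ∨ P4 u v)
    (fun u v => if P1 u v then spoke u v else if P2 u v then edge u else
      if P3 u v then closing u else ext u v) (by
    intro u v h1 h2
    simp only [P1, P2, P3, P4, IsFreeEnd, IsInterior, IsConsecutive] at h1 h2
    have h3 := hDN u
    have h4 := hDN v
    have hlen : L u = L v → (L u).length = (L v).length := fun h => by rw [h]
    have hlen' : L v = L u → (L u).length = (L v).length := fun h => by rw [h]
    rcases h1 with h1 | h1 | h1 | h1 <;> rcases h2 with h2 | h2 | h2 | h2 <;>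
      first
      | exact absurd h1.2 (h4 h2.1)
      | exact absurd h2.2 (h3 h1.1)
      | exact absurd h1.2 (h4 h2.2.1)
      | exact absurd h2.2 (h3 h1.2.1)
      | exact absurd h1.2 (h4 h2.1.1)
      | exact absurd h2.2 (h3 h1.1.1)
      | grind)
  refine ⟨c, ?_, ?_, ?_, ?_⟩
  · intro v hv d hd
    rw [hc v d (Or.inl ⟨hv, hd⟩), if_pos ⟨hv, hd⟩]
  · intro u hu v hv hL hp
    have h2 : P2 u v := ⟨hu, hv, hL, hp⟩
    rw [hc u v (Or.inr (Or.inl h2)), if_neg (fun h : P1 u v => hDN v hv h.2), if_pos h2]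
  · intro u hu v hv hL hp hp' h3
    have h2 : P3 u v := ⟨hu, hv, hL, hp, hp', h3⟩
    rw [hc u v (Or.inr (Or.inr (Or.inl h2))), if_neg (fun h : P1 u v => hDN v hv h.2),
      if_neg (fun h : P2 u v => by have := h.2.2.2; omega), if_pos h2]
  · intro u v hu hv huv
    have h2 : P4 u v := ⟨hu, hv, huv⟩
    rw [hc u v (Or.inr (Or.inr (Or.inr h2))), if_neg (fun h : P1 u v => hDN v hv.1 h.2),
      if_neg (fun h : P2 u v => huv ⟨h.2.2.1, Or.inl h.2.2.2⟩),
      if_neg (fun h : P3 u v => by have := h.2.2.2.1; have := hv.2.2.1; omega)]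

end PathSystem

/-! ### The six-coloring at the first layer -/

section Layer

variable {V : Type*} {G : SimpleGraph V} {D N : Finset V} {c : Sym2 V → Fin 3 ⊕ Fin 3}

/-- `v` can be attached to `D` by a path with inner colors from `S`, the last edge of which is a
spoke of color `j`. -/
def AttachableVia (G : SimpleGraph V) (D : Finset V) (c : Sym2 V → Fin 3 ⊕ Fin 3) (v : V)
    (j : Fin 3) (S : Finset (Fin 3)) : Prop :=
  Attachable G D c v (insert (Sum.inl j) (S.image Sum.inr))

namespace AttachableVia

theorem mono {v : V} {j : Fin 3} {S S' : Finset (Fin 3)} (h : AttachableVia G D c v j S)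
    (hS : S ⊆ S') : AttachableVia G D c v j S' :=
  Attachable.mono h (Finset.insert_subset_insert _ (Finset.image_subset_image hS))

theorem of_spoke {v d : V} {j : Fin 3} (hv : v ∉ D) (hd : d ∈ D) (h : G.Adj v d)
    (hc : c s(v, d) = Sum.inl j) : AttachableVia G D c v j ∅ :=
  Attachable.insert hv h hc (by simp) (.base hd)

theorem step {v u : V} {x j : Fin 3} {S : Finset (Fin 3)} (hu : AttachableVia G D c u j S)
    (hv : v ∉ D) (h : G.Adj v u) (hc : c s(v, u) = Sum.inr x) (hx : x ∉ S) :
    AttachableVia G D c v j (insert x S) := by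
  unfold AttachableVia at *
  rw [Finset.image_insert, Finset.insert_comm]
  exact Attachable.insert hv h hc (by simpa using hx) hu

end AttachableVia

theorem fin_three_cases : ∀ i j : Fin 3, j = i ∨ j = i + 1 ∨ j = i + 2 := by decide

theorem endInner_self : ∀ b i, endInner b i i = ∅ := by decide
theorem endInner_true_add_one : ∀ i, endInner true i (i + 1) = {i} := by decide
theorem endInner_true_add_two : ∀ i, endInner true i (i + 2) = {i + 1, i + 2} := by decide
theorem endInner_false_add_one : ∀ i, endInner false i (i + 1) = {i, i + 1} := by decide
theorem endInner_false_add_two : ∀ i, endInner false i (i + 2) = {i + 2} := by decide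
theorem midInner_self : ∀ g i, midInner g i i = ∅ := by decide
theorem midInner_add_one : ∀ g i, midInner g i (i + 1) = if g = 2 then {i + 1} else {i} := by decide
theorem midInner_add_two : ∀ g i, midInner g i (i + 2) = if g = 1 then {i + 1} else {i + 2} := by
  decide

/-- The vertex `v` has attachments as the ends of the paths of a path system. -/
def IsEndType (G : SimpleGraph V) (D : Finset V) (c : Sym2 V → Fin 3 ⊕ Fin 3) (v : V)
    (b : Bool) (i : Fin 3) : Prop :=
  ∀ j, AttachableVia G D c v j (endInner b i j)

/-- The vertex `v` has attachments as the inner vertices of the paths of a path system. -/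
def IsMidType (G : SimpleGraph V) (D : Finset V) (c : Sym2 V → Fin 3 ⊕ Fin 3) (v : V)
    (g i : Fin 3) : Prop :=
  ∀ j, AttachableVia G D c v j (midInner g i j)

theorem isEndType_true {v : V} {i : Fin 3} (h0 : AttachableVia G D c v i ∅)
    (h1 : AttachableVia G D c v (i + 1) {i}) (h2 : AttachableVia G D c v (i + 2) {i + 1, i + 2}) :
    IsEndType G D c v true i := by
  intro j
  rcases fin_three_cases i j with rfl | rfl | rfl
  · rwa [endInner_self]
  · rwa [endInner_true_add_one]
  · rwa [endInner_true_add_two]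

theorem isEndType_false {v : V} {i : Fin 3} (h0 : AttachableVia G D c v i ∅)
    (h1 : AttachableVia G D c v (i + 1) {i, i + 1}) (h2 : AttachableVia G D c v (i + 2) {i + 2}) :
    IsEndType G D c v false i := by
  intro j
  rcases fin_three_cases i j with rfl | rfl | rfl
  · rwa [endInner_self]
  · rwa [endInner_false_add_one]
  · rwa [endInner_false_add_two]

theorem isMidType_of {v : V} {g i : Fin 3} (h0 : AttachableVia G D c v i ∅)
    (h1 : AttachableVia G D c v (i + 1) (if g = 2 then {i + 1} else {i}))
    (h2 : AttachableVia G D c v (i + 2) (if g = 1 then {i + 1} else {i + 2})) :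
    IsMidType G D c v g i := by
  intro j
  rcases fin_three_cases i j with rfl | rfl | rfl
  · rwa [midInner_self]
  · rwa [midInner_add_one]
  · rwa [midInner_add_two]

/-- A first vertex of label `i` reaches its missing spoke color `i + 2` through an inner vertex `v`
of any label `l`: the color of `uv` is chosen, depending on `l`, from `{i + 1, i + 2}` so as not to
repeat the inner color used at `v`. The next theorem is the mirror image for last vertices. -/
theorem AttachableVia.of_mid_true {u v : V} {i l : Fin 3} (hv : IsMidType G D c v 0 l)
    (hu : u ∉ D) (h : G.Adj u v)
    (hc : c s(u, v) = Sum.inr (if l = i then i + 1 else i + 2)) :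
    AttachableVia G D c u (i + 2) {i + 1, i + 2} := by
  refine ((hv (i + 2)).step hu h hc ?_).mono ?_
  · clear hc hv
    decide +revert
  · clear hc hv
    decide +revert

theorem AttachableVia.of_mid_false {u v : V} {i l : Fin 3} (hv : IsMidType G D c v 0 l)
    (hu : u ∉ D) (h : G.Adj u v)
    (hc : c s(u, v) = Sum.inr (if l = i then i + 1 else i)) :
    AttachableVia G D c u (i + 1) {i, i + 1} := by
  refine ((hv (i + 1)).step hu h hc ?_).mono ?_
  · clear hc hv
    decide +revert
  · clear hc hv
    decide +revert

end Layer

section Layer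

variable {V : Type*} {G : SimpleGraph V} {D N : Finset V} {L : V → List V} {pos : V → ℕ}
  {κ : V → Bool}

/-- The hypothesis on `κ` says that paths are directed from their `true` end to their `false` end; a
path with a single vertex may have either type. In `h3`, excluding `p` and `q` encodes three
neighbors in `D ∪ N`. -/
theorem exists_end_mid_coloring (hDN : ∀ v ∈ N, v ∉ D) (hS : IsPathSystem G N L pos)
    (hd : ∀ v ∈ N, ∃ d ∈ D, G.Adj v d)
    (h3 : ∀ v ∈ N, ∀ p q, ∃ y, (y ∈ D ∨ y ∈ N) ∧ G.Adj v y ∧ y ≠ p ∧ y ≠ q)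
    (hκ : ∀ u ∈ N, ∀ v ∈ N, L u = L v → pos u = 0 → pos v + 1 = (L v).length →
      2 ≤ (L v).length → κ u = true ∧ κ v = false) :
    ∃ c : Sym2 V → Fin 3 ⊕ Fin 3, ∀ v ∈ N, (∃ g i, IsMidType G D c v g i) ∨
      ∃ i, IsEndType G D c v (κ v) i := by
  classical
  -- chosen neighbors
  choose! d hdD hdA using hd
  -- The second neighbor `x v` is taken in `N` whenever possible. If it lies in `D`, all relevant
  -- neighbors of `v` are in `D`, and spokes alone give `v` all three colors.
  have hx : ∀ v ∈ N, ∃ x, G.Adj v x ∧ x ≠ d v ∧ (x ∈ N ∨ (x ∈ D ∧ ∀ y ∈ N, ¬ G.Adj v y)) := by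
    intro v hv
    by_cases h : ∃ y ∈ N, G.Adj v y
    · obtain ⟨y, hy, hvy⟩ := h
      exact ⟨y, hvy, fun h => hDN y hy (h ▸ hdD v hv), Or.inl hy⟩
    · push Not at h
      obtain ⟨y, hy, hvy, hyd, -⟩ := h3 v hv (d v) (d v)
      refine ⟨y, hvy, hyd, Or.inr ⟨?_, h⟩⟩
      exact hy.resolve_right fun hyN => h y hyN hvy
  choose! x hxA hxd hxN using hx
  -- labels and colors
  let P : V → Fin 3 := fun v => Fin.ofNat 3 (pos v)
  have hP : ∀ v (i : Fin 3), pos v % 3 = i.val → P v = i := fun v i h => Fin.ext h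
  have hPs : ∀ u v, pos v = pos u + 1 → P v = P u + 1 := by
    intro u v h
    apply Fin.ext
    simp only [P, h, Fin.ofNat, Fin.val_add]
    omega
  -- A path with one vertex has no position to respect, so its label is adapted to that of `x v`:
  -- the latter becomes `lam v + 1` for type `true` and `lam v + 2` for type `false`, as for a
  -- successor or a predecessor.
  let lam : V → Fin 3 := fun v =>
    if (L v).length = 1 ∧ x v ∈ N then P (x v) + (if κ v then 2 else 1) else P v
  -- The path edge to the successor has the label as its color, except that on a cycle of length 2
  -- modulo 3 the first and the last path edge are recolored with 2 and 1.
  let E : V → Fin 3 := fun v =>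
    if IsCyclicAt G N L pos v ∧ (L v).length % 3 = 2 ∧ pos v = 0 then 2 else
    if IsCyclicAt G N L pos v ∧ (L v).length % 3 = 2 ∧ pos v + 2 = (L v).length then 1 else P v
  -- The closing color `2n + 2` modulo 3 is 2, 1, 0 for cycle length `n` congruent to 0, 1, 2. For
  -- `n` divisible by 3 this continues the pattern periodically; in the other cases it suits the
  -- routes of the two ends over the closing edge.
  obtain ⟨c, hc1, hc2, hc3, hc4⟩ := exists_layer_coloring (G := G) (L := L) (pos := pos) hDN
    (fun v y => (Sum.inl (if y = d v then lam v else if y = x v then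
      lam v + (if κ v then 1 else 2) else lam v + (if κ v then 2 else 1)) : Fin 3 ⊕ Fin 3))
    (fun v => Sum.inr (E v)) (fun v => Sum.inr (Fin.ofNat 3 (2 * (L v).length + 2)))
    (fun u v => Sum.inr (if (L u).length = 1 ∧ v = x u then (if κ u then lam u else lam u + 2) else
      if P v = lam u then lam u + 1 else if κ u then lam u + 2 else lam u))
  -- attachments by spokes
  have hlam : ∀ v, 2 ≤ (L v).length → lam v = P v := by
    intro v hv
    simp only [lam]
    rw [if_neg (by omega)]
  have hsp0 : ∀ v ∈ N, AttachableVia G D c v (lam v) ∅ := by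
    intro v hv
    refine .of_spoke (hDN v hv) (hdD v hv) (hdA v hv) ?_
    rw [hc1 v hv _ (hdD v hv), if_pos rfl]
  have hsp : ∀ v ∈ N, 2 ≤ (L v).length → AttachableVia G D c v (P v) ∅ := by
    intro v hv h
    rw [← hlam v h]
    exact hsp0 v hv
  have hsp2 : ∀ v ∈ N, ∀ y ∈ D, G.Adj v y → y ≠ d v → y ≠ x v →
      AttachableVia G D c v (lam v + (if κ v then 2 else 1)) ∅ := by
    intro v hv y hy hvy h1 h2
    refine .of_spoke (hDN v hv) hy hvy ?_
    rw [hc1 v hv _ hy, if_neg h1, if_neg h2]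
  -- attachments by edges of paths
  have hsucc : ∀ u ∈ N, ∀ v ∈ N, L u = L v → pos v = pos u + 1 → ∀ j S e,
      AttachableVia G D c v j S → E u = e → e ∉ S → AttachableVia G D c u j (insert e S) := by
    rintro u hu v hv hL hp j S e h rfl he
    exact h.step (hDN u hu) (hS.adj_succ hu hv hL hp) (hc2 u hu v hv hL hp) he
  have hpred : ∀ u ∈ N, ∀ v ∈ N, L u = L v → pos v = pos u + 1 → ∀ j S e,
      AttachableVia G D c u j S → E u = e → e ∉ S → AttachableVia G D c v j (insert e S) := by
    rintro u hu v hv hL hp j S e h rfl he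
    refine h.step (hDN v hv) (hS.adj_succ hu hv hL hp).symm ?_ he
    rw [Sym2.eq_swap]
    exact hc2 u hu v hv hL hp
  have hex : ∀ v ∈ N, ∀ i, i < (L v).length → ∃ u ∈ N, L u = L v ∧ pos u = i :=
    fun v hv i hi => hS.exists_pos_eq hv hi
  -- inner vertices with the regular colors around
  have hmid : ∀ v ∈ N, 0 < pos v → pos v + 1 < (L v).length → E v = P v →
      (∀ u, L u = L v → pos u + 1 = pos v → E u = P u) → IsMidType G D c v 0 (P v) := by
    intro v hv h0 h1 hE hE'
    obtain ⟨s, hsN, hsL, hsp'⟩ := hex v hv _ h1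
    obtain ⟨p, hpN, hpL, hpp⟩ := hex v hv (pos v - 1) (by omega)
    have e1 := hPs v s hsp'
    have e2 := hPs p v (by omega)
    refine isMidType_of (hsp v hv (by omega)) ?_ ?_
    · rw [if_neg (by decide)]
      have := hsp s hsN (by rw [hsL]; omega)
      rw [e1] at this
      exact hsucc v hv s hsN hsL.symm hsp' _ _ _ this hE (by simp)
    · rw [if_neg (by decide)]
      have h4 : P p = P v + 2 := by
        rw [e2]
        generalize P p = i
        revert i
        decide
      have := hsp p hpN (by rw [hpL]; omega)
      rw [h4] at this
      exact hpred p hpN v hv hpL (by omega) _ _ _ this ((hE' p hpL (by omega)).trans h4) (by simp)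
  have hEreg : ∀ v, ¬ (IsCyclicAt G N L pos v ∧ (L v).length % 3 = 2) → E v = P v := by
    intro v h
    simp only [E]
    rw [if_neg (fun h' => h ⟨h'.1, h'.2.1⟩), if_neg (fun h' => h ⟨h'.1, h'.2.1⟩)]
  have hintr : ∀ v, IsInterior G N L pos v → IsMidType G D c v 0 (P v) := by
    rintro v ⟨hv, hvc, h0, h1⟩
    refine hmid v hv h0 h1 (hEreg v fun h => hvc h.1) fun u hu _ => hEreg u fun h => hvc ?_
    exact (isCyclicAt_congr hu).mp h.1
  -- attachments of the free ends by other edges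
  have hext : ∀ u, IsFreeEnd G N L pos u → ∀ y, (y ∈ D ∨ y ∈ N) → G.Adj u y → y ≠ d u →
      y ≠ x u ∨ (2 ≤ (L u).length ∧ x u ∈ N) → (y ∈ N → ¬ IsConsecutive L pos u y) →
      (κ u = true → AttachableVia G D c u (lam u + 2) {lam u + 1, lam u + 2}) ∧
      (κ u = false → AttachableVia G D c u (lam u + 1) {lam u, lam u + 1}) := by
    intro u hu y hy huy hyd hyx hcons
    rcases hy with hy | hy
    · have h1 : y ≠ x u := hyx.elim id fun h e => hDN _ h.2 (e ▸ hy)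
      have := hsp2 u hu.1 y hy huy hyd h1
      constructor <;> intro hk <;> simp only [hk, if_true, Bool.false_eq_true, if_false] at this <;>
        exact this.mono (by simp)
    · have hyint := hS.isInterior_of_adj hu hy huy (hcons hy)
      have h1 := hc4 u y hu hyint (hcons hy)
      have h2 : ¬ ((L u).length = 1 ∧ y = x u) := by
        rintro ⟨h2, h4⟩
        rcases hyx with h5 | h5
        · exact h5 h4
        · omega
      rw [if_neg h2] at h1
      constructor <;> intro hk <;> simp only [hk, if_true, Bool.false_eq_true, if_false] at h1
      · exact .of_mid_true (hintr y hyint) (hDN u hu.1) huy h1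
      · exact .of_mid_false (hintr y hyint) (hDN u hu.1) huy h1
  refine ⟨c, fun v hv => ?_⟩
  have hlt := hS.pos_lt hv
  by_cases hcyc : IsCyclicAt G N L pos v
  · -- a path that closes up to a cycle
    obtain ⟨hn, h, hhN, t, htN, hhL, htL, hh0, htn, hht⟩ := hcyc
    obtain ⟨p, hpN, hpL, hp1⟩ := hex v hv 1 (by omega)
    obtain ⟨q, hqN, hqL, hqn⟩ := hex v hv ((L v).length - 2) (by omega)
    have hpA := hsp p hpN (by rw [hpL]; omega)
    have hqA := hsp q hqN (by rw [hqL]; omega)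
    have hhA := hsp h hhN (by rw [hhL]; omega)
    have htA := hsp t htN (by rw [htL]; omega)
    have hvA := hsp v hv (by omega)
    have hPh : P h = 0 := hP h 0 (by rw [hh0]; rfl)
    have hPp : P p = 1 := hP p 1 (by rw [hp1]; rfl)
    have hκv := hκ h hhN t htN (hhL.trans htL.symm) hh0 (by rw [htL]; exact htn)
      (by rw [htL]; omega)
    have hcl : c s(t, h) = Sum.inr (Fin.ofNat 3 (2 * (L v).length + 2)) := by
      rw [hc3 t htN h hhN (htL.trans hhL.symm) hh0 (by rw [hhL]; exact htn) (by rw [hhL]; exact hn),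
        htL]
    have hclh : ∀ j S e, AttachableVia G D c t j S → 2 * (L v).length % 3 + 2 = 3 + e.val ∨
        2 * (L v).length % 3 + 2 = e.val → e ∉ S → AttachableVia G D c h j (insert e S) := by
      intro j S e h1 he h2
      refine h1.step (hDN h hhN) hht ?_ h2
      rw [Sym2.eq_swap, hcl]
      congr 1
      apply Fin.ext
      simp only [Fin.ofNat]
      omega
    have hclt : ∀ j S e, AttachableVia G D c h j S → 2 * (L v).length % 3 + 2 = 3 + e.val ∨
        2 * (L v).length % 3 + 2 = e.val → e ∉ S → AttachableVia G D c t j (insert e S) := by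
      intro j S e h1 he h2
      refine h1.step (hDN t htN) hht.symm ?_ h2
      rw [hcl]
      congr 1
      apply Fin.ext
      simp only [Fin.ofNat]
      omega
    have hEc : ∀ u, L u = L v → E u = if (L v).length % 3 = 2 ∧ pos u = 0 then 2 else
        if (L v).length % 3 = 2 ∧ pos u + 2 = (L v).length then 1 else P u := by
      intro u hu
      have : IsCyclicAt G N L pos u :=
        (isCyclicAt_congr hu).mpr ⟨hn, h, hhN, t, htN, hhL, htL, hh0, htn, hht⟩
      simp only [E, this, hu, true_and]
    have hhp := hsucc h hhN p hpN (hhL.trans hpL.symm) (by omega)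
    have hph := hpred h hhN p hpN (hhL.trans hpL.symm) (by omega)
    have hqt := hsucc q hqN t htN (hqL.trans htL.symm) (by omega)
    have htq := hpred q hqN t htN (hqL.trans htL.symm) (by omega)
    -- For length 2 modulo 3 the irregular edge colors also affect the second and the second to last
    -- vertex. They become inner vertices of the variants `g = 1` and `g = 2`; the length is at
    -- least 5, so these two are distinct.
    by_cases hn2 : (L v).length % 3 = 2
    · obtain ⟨p', hpN', hpL', hp2⟩ := hex v hv 2 (by omega)
      obtain ⟨q', hqN', hqL', hqn'⟩ := hex v hv ((L v).length - 3) (by omega)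
      have hpA' := hsp p' hpN' (by rw [hpL']; omega)
      have hqA' := hsp q' hqN' (by rw [hqL']; omega)
      have hPp' : P p' = 2 := hP p' 2 (by rw [hp2]; rfl)
      have hPq : P q = 0 := hP q 0 (by rw [Fin.val_zero]; omega)
      have hPt : P t = 1 := hP t 1 (by rw [Fin.val_one]; omega)
      have hPq' : P q' = 2 := hP q' 2 (by rw [Fin.val_two]; omega)
      have hEh : E h = 2 := by rw [hEc h hhL, if_pos ⟨hn2, hh0⟩]
      have hEp : E p = 1 := by
        rw [hEc p hpL, if_neg (by omega), if_neg (by omega), hPp]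
      have hEq : E q = 1 := by
        rw [hEc q hqL, if_neg (by omega), if_pos (by omega)]
      have hEq' : E q' = 2 := by
        rw [hEc q' hqL', if_neg (by omega), if_neg (by omega), hPq']
      rw [hPh] at hhA
      rw [hPp] at hpA
      rw [hPp'] at hpA'
      rw [hPq] at hqA
      rw [hPq'] at hqA'
      rw [hPt] at htA
      have hpp' := hsucc p hpN p' hpN' (hpL.trans hpL'.symm) (by omega) _ _ _ hpA' hEp (by decide)
      have hqq' := hpred q' hqN' q hqN (hqL'.trans hqL.symm) (by omega) _ _ _ hqA' hEq' (by decide)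
      rcases (by omega : pos v = 0 ∨ pos v + 1 = (L v).length ∨
        (0 < pos v ∧ pos v + 1 < (L v).length)) with h0 | h1 | ⟨h0, h1⟩
      · have e : v = h := hS.injOn hv hhN hhL.symm (by omega)
        rw [e, hκv.1]
        refine Or.inr ⟨0, isEndType_true hhA ?_ ?_⟩
        · exact hclh _ _ 0 htA (by rw [Fin.val_zero]; omega) (by decide)
        · exact (hhp _ _ _ hpp' hEh (by decide)).mono (by decide)
      · have e : v = t := hS.injOn hv htN htL.symm (by omega)
        rw [e, hκv.2]
        refine Or.inr ⟨1, isEndType_false htA ?_ ?_⟩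
        · exact (htq _ _ _ hqq' hEq (by decide)).mono (by decide)
        · exact (hclt _ _ 0 hhA (by rw [Fin.val_zero]; omega) (by decide)).mono (by decide)
      · left
        by_cases hv1 : pos v = 1
        · have e : v = p := hS.injOn hv hpN hpL.symm (by omega)
          rw [e]
          refine ⟨1, 1, isMidType_of hpA ?_ ?_⟩
          · exact hpp'.mono (by decide)
          · exact (hph _ _ _ hhA hEh (by decide)).mono (by decide)
        by_cases hv2 : pos v + 2 = (L v).length
        · have e : v = q := hS.injOn hv hqN hqL.symm (by omega)
          rw [e]
          refine ⟨2, 0, isMidType_of hqA ?_ ?_⟩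
          · exact (hqt _ _ _ htA hEq (by decide)).mono (by decide)
          · exact hqq'.mono (by decide)
        refine ⟨_, _, hmid v hv h0 h1 ?_ ?_⟩
        · rw [hEc v rfl, if_neg (by omega), if_neg (by omega)]
        · intro u huL hup
          rw [hEc u huL, if_neg (by omega), if_neg (by omega)]
    · have hEP : ∀ u, L u = L v → E u = P u := by
        intro u hu
        rw [hEc u hu, if_neg (fun h => hn2 h.1), if_neg (fun h => hn2 h.1)]
      rw [hPh] at hhA
      rw [hPp] at hpA
      have hEh : E h = 0 := (hEP h hhL).trans hPh
      have hhp1 := hhp _ _ _ hpA hEh (by decide)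
      rcases (by omega : pos v = 0 ∨ pos v + 1 = (L v).length ∨
        (0 < pos v ∧ pos v + 1 < (L v).length)) with h0 | h1 | ⟨h0, h1⟩
      · have e : v = h := hS.injOn hv hhN hhL.symm (by omega)
        rw [e, hκv.1]
        by_cases hn0 : (L v).length % 3 = 0
        · have hPt : P t = 2 := hP t 2 (by rw [Fin.val_two]; omega)
          rw [hPt] at htA
          refine Or.inr ⟨0, isEndType_true hhA hhp1 ?_⟩
          exact (hclh _ _ 2 htA (by rw [Fin.val_two]; omega) (by decide)).mono (by decide)
        · have hPq : P q = 2 := hP q 2 (by rw [Fin.val_two]; omega)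
          rw [hPq] at hqA
          have htq1 := htq _ _ _ hqA ((hEP q hqL).trans hPq) (by decide)
          refine Or.inr ⟨0, isEndType_true hhA hhp1 ?_⟩
          exact (hclh _ _ 1 htq1 (by rw [Fin.val_one]; omega) (by decide)).mono (by decide)
      · have e : v = t := hS.injOn hv htN htL.symm (by omega)
        rw [e, hκv.2]
        by_cases hn0 : (L v).length % 3 = 0
        · have hPt : P t = 2 := hP t 2 (by rw [Fin.val_two]; omega)
          have hPq : P q = 1 := hP q 1 (by rw [Fin.val_one]; omega)
          rw [hPt] at htA
          rw [hPq] at hqA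
          have htq1 := htq _ _ _ hqA ((hEP q hqL).trans hPq) (by decide)
          refine Or.inr ⟨2, isEndType_false htA ?_ ?_⟩
          · exact (hclt _ _ 2 hhA (by rw [Fin.val_two]; omega) (by decide)).mono (by decide)
          · exact htq1.mono (by decide)
        · have hPt : P t = 0 := hP t 0 (by rw [Fin.val_zero]; omega)
          have hPq : P q = 2 := hP q 2 (by rw [Fin.val_two]; omega)
          rw [hPt] at htA
          rw [hPq] at hqA
          have htq1 := htq _ _ _ hqA ((hEP q hqL).trans hPq) (by decide)
          refine Or.inr ⟨0, isEndType_false htA ?_ ?_⟩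
          · exact (hclt _ _ 1 hhp1 (by rw [Fin.val_one]; omega) (by decide)).mono (by decide)
          · exact htq1.mono (by decide)
      · exact Or.inl ⟨_, _, hmid v hv h0 h1 (hEP v rfl) fun u hu _ => hEP u hu⟩
  by_cases hint : IsInterior G N L pos v
  · exact Or.inl ⟨_, _, hintr v hint⟩
  have hend : IsFreeEnd G N L pos v := by
    refine ⟨hv, hcyc, ?_⟩
    by_contra h
    exact hint ⟨hv, hcyc, by omega, by omega⟩
  right
  refine ⟨lam v, ?_⟩
  rcases Nat.lt_or_ge (L v).length 2 with hlen | hlen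
  · -- a path with one vertex
    have hlen1 : (L v).length = 1 := by omega
    have hcons : ∀ y ∈ N, ¬ IsConsecutive L pos v y := by
      rintro y hy ⟨h1, h2⟩
      have h4 := hS.pos_lt hy
      rw [← h1] at h4
      omega
    -- A vertex alone on its path needs two extra routes: through `x v` it reaches one of the two
    -- missing spoke colors with at most one inner color, and through `y` the other.
    obtain ⟨y, hy, hvy, hyd, hyx⟩ := h3 v hv (d v) (x v)
    rcases hxN v hv with hxv | ⟨hxv, hxv'⟩
    · have hxint := hS.isInterior_of_adj hend hxv (hxA v hv) (hcons _ hxv)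
      have hx1 := hc4 v (x v) hend hxint (hcons _ hxv)
      rw [if_pos ⟨hlen1, rfl⟩] at hx1
      have hxx : AttachableVia G D c (x v) (P (x v)) ∅ := hsp _ hxv (by
        have := hxint.2.2; omega)
      have hy2 := hext v hend y hy hvy hyd (Or.inl hyx) (hcons y)
      have hl : lam v = P (x v) + (if κ v then 2 else 1) := by
        simp only [lam]
        rw [if_pos ⟨hlen1, hxv⟩]
      cases hk : κ v
      · simp only [hk, Bool.false_eq_true, if_false] at hx1 hl
        refine isEndType_false (hsp0 v hv) (hy2.2 hk) ?_
        have h5 : P (x v) = lam v + 2 := by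
          rw [hl]
          generalize P (x v) = i
          revert i
          decide
        rw [h5] at hxx
        exact hxx.step (hDN v hv) (hxA v hv) hx1 (by simp)
      · simp only [hk, if_true] at hx1 hl
        refine isEndType_true (hsp0 v hv) ?_ (hy2.1 hk)
        have h5 : P (x v) = lam v + 1 := by
          rw [hl]
          generalize P (x v) = i
          revert i
          decide
        rw [h5] at hxx
        exact hxx.step (hDN v hv) (hxA v hv) hx1 (by simp)
    · have hyD : y ∈ D := hy.resolve_right fun h => hxv' y h hvy
      have s2 := hsp2 v hv y hyD hvy hyd hyx
      have s1 : AttachableVia G D c v (lam v + (if κ v then 1 else 2)) ∅ := by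
        refine .of_spoke (hDN v hv) hxv (hxA v hv) ?_
        rw [hc1 v hv _ hxv, if_neg (hxd v hv), if_pos rfl]
      cases hk : κ v
      · simp only [hk, Bool.false_eq_true, if_false] at s1 s2
        exact isEndType_false (hsp0 v hv) (s2.mono (by simp)) (s1.mono (by simp))
      · simp only [hk, if_true] at s1 s2
        exact isEndType_true (hsp0 v hv) (s1.mono (by simp)) (s2.mono (by simp))
  · -- an end of a path with at least two vertices
    have hl := hlam v hlen
    have hEv : E v = P v := hEreg v fun h => hcyc h.1
    have hxNv : ∀ y ∈ N, G.Adj v y → x v ∈ N := fun y hy hvy =>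
      (hxN v hv).elim id fun h => absurd hvy (h.2 y hy)
    rcases hend.2.2 with h0 | h1
    · obtain ⟨t, htN, htL, htp⟩ := hex v hv ((L v).length - 1) (by omega)
      have hk := (hκ v hv t htN htL.symm h0 (by rw [htL]; omega) (by rw [htL]; omega)).1
      obtain ⟨s, hsN, hsL, hsp'⟩ := hex v hv 1 (by omega)
      obtain ⟨y, hy, hvy, hyd, hys⟩ := h3 v hv (d v) s
      have hy2 := hext v hend y hy hvy hyd (Or.inr ⟨hlen, hxNv s hsN
        (hS.adj_succ hv hsN hsL.symm (by omega))⟩) (by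
          rintro hyN ⟨h5, h6⟩
          exact hys (hS.injOn hyN hsN (h5.symm.trans hsL.symm) (by omega)))
      rw [hk]
      refine isEndType_true (hsp0 v hv) ?_ (hy2.1 hk)
      have := hsp s hsN (by rw [hsL]; omega)
      rw [hPs v s (by omega), ← hl] at this
      exact hsucc v hv s hsN hsL.symm (by omega) _ _ _ this (hEv.trans hl.symm) (by simp)
    · obtain ⟨t, htN, htL, htp⟩ := hex v hv 0 (by omega)
      have hk := (hκ t htN v hv htL htp h1 hlen).2
      obtain ⟨s, hsN, hsL, hsp'⟩ := hex v hv (pos v - 1) (by omega)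
      obtain ⟨y, hy, hvy, hyd, hys⟩ := h3 v hv (d v) s
      have hy2 := hext v hend y hy hvy hyd (Or.inr ⟨hlen, hxNv s hsN
        (hS.adj_succ hsN hv hsL (by omega)).symm⟩) (by
          rintro hyN ⟨h5, h6⟩
          have h7 := hS.pos_lt hyN
          rw [← h5] at h7
          exact hys (hS.injOn hyN hsN (h5.symm.trans hsL.symm) (by omega)))
      rw [hk]
      refine isEndType_false (hsp0 v hv) (hy2.2 hk) ?_
      have e : P s = lam v + 2 := by
        rw [hl, hPs s v (by omega)]
        generalize P s = i
        revert i
        decide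
      have := hsp s hsN (by rw [hsL]; omega)
      rw [e] at this
      refine hpred s hsN v hv hsL (by omega) _ _ _ this ?_ (by simp)
      rw [← e]
      exact hEreg s fun h => hcyc ((isCyclicAt_congr hsL).mp h.1)

end Layer

section Layer

variable {V : Type*} {G : SimpleGraph V} {D N : Finset V}

/-- The coloring of the edges at a first layer `N`, in which the type of an end of a path can be
prescribed up to a pairing of the ends. -/
theorem exists_mate_coloring (hDN : ∀ v ∈ N, v ∉ D) (hd : ∀ v ∈ N, ∃ d ∈ D, G.Adj v d)
    (h3 : ∀ v ∈ N, ∀ p q, ∃ y, (y ∈ D ∨ y ∈ N) ∧ G.Adj v y ∧ y ≠ p ∧ y ≠ q) :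
    ∃ mate : V → V, Function.Involutive mate ∧ ∀ κ : V → Bool,
      (∀ v, mate v ≠ v → κ (mate v) ≠ κ v) →
      ∃ c : Sym2 V → Fin 3 ⊕ Fin 3, ∀ v ∈ N, (∃ g i, IsMidType G D c v g i) ∨
        ∃ i, IsEndType G D c v (κ v) i := by
  classical
  obtain ⟨L, pos, hS⟩ := exists_isPathSystem G N
  have hm : ∀ v ∈ N, ∃ m ∈ N, L m = L v ∧ (pos v = 0 → pos m + 1 = (L v).length) ∧
      (pos v ≠ 0 → pos v + 1 = (L v).length → pos m = 0) ∧
      (pos v ≠ 0 → pos v + 1 ≠ (L v).length → pos m = pos v) := by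
    intro v hv
    have hlt := hS.pos_lt hv
    by_cases h0 : pos v = 0
    · obtain ⟨u, h1, h2, h4⟩ := hS.exists_pos_eq hv (i := (L v).length - 1) (by omega)
      exact ⟨u, h1, h2, fun _ => by omega, fun h => absurd h0 h, fun h => absurd h0 h⟩
    by_cases h1 : pos v + 1 = (L v).length
    · obtain ⟨u, h2, h4, h5⟩ := hS.exists_pos_eq hv (i := 0) (by omega)
      exact ⟨u, h2, h4, fun h => absurd h h0, fun _ _ => h5, fun _ h => absurd h1 h⟩
    · exact ⟨v, hv, rfl, fun h => absurd h h0, fun _ h => absurd h h1, fun _ _ => rfl⟩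
  choose! m hmN hmL hm0 hm1 hm2 using hm
  refine ⟨fun v => if v ∈ N then m v else v, ?_, fun κ hκ => ?_⟩
  · intro v
    by_cases hv : v ∈ N
    · simp only [hv, if_true, hmN v hv]
      have h1 := hmN v hv
      refine hS.injOn (hmN _ h1) hv ((hmL _ h1).trans (hmL v hv)) ?_
      have e1 := hm0 v hv
      have e2 := hm1 v hv
      have e3 := hm2 v hv
      have e4 := hm0 _ h1
      have e5 := hm1 _ h1
      have e6 := hm2 _ h1
      have h2 := hS.pos_lt hv
      rw [hmL v hv] at e4 e5 e6
      omega
    · simp [hv]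
  · let p : List V → Prop := fun l => ∃ x, l.head? = some x ∧ κ x = false
    have hmate : ∀ u ∈ N, ∀ v ∈ N, L u = L v → pos u = 0 → pos v + 1 = (L v).length →
        2 ≤ (L v).length → κ v ≠ κ u := by
      intro u hu v hv hL h0 h1 h2
      have h4 : m u = v := by
        refine hS.injOn (hmN u hu) hv ((hmL u hu).trans hL) ?_
        have := hm0 u hu h0
        rw [hL] at this
        omega
      have h5 := hκ u
      simp only [hu, if_true, h4] at h5
      refine h5 ?_
      rintro rfl
      omega
    refine exists_end_mid_coloring hDN (hS.reverse p) hd h3 ?_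
    intro u hu v hv hL h0 h1 h2
    have hLuv : L u = L v := by
      have h4 : u ∈ if p (L u) then (L u).reverse else L u := by
        have := List.mem_of_getElem? (hS.getElem?_pos u hu)
        split_ifs
        · exact List.mem_reverse.mpr this
        · exact this
      rw [hL] at h4
      have h5 : u ∈ L v := by
        split_ifs at h4
        · exact List.mem_reverse.mp h4
        · exact h4
      obtain ⟨i, hi⟩ := List.mem_iff_getElem?.mp h5
      exact (hS.eq_of_getElem? v hv i u hi).2.1
    have hlt := hS.pos_lt hv
    have hlt' := hS.pos_lt hu
    rw [hLuv] at h0 hlt'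
    by_cases hp : p (L v)
    · rw [if_pos hp] at h0 h1 h2
      rw [if_pos hp] at h1
      rw [List.length_reverse] at h1 h2
      have hvu := hmate v hv u hu hLuv.symm (by omega) (by rw [hLuv]; omega) (by rw [hLuv]; omega)
      obtain ⟨x, hx, hxκ⟩ := hp
      have h4 := hS.getElem?_pos v hv
      rw [show pos v = 0 by omega, ← List.head?_eq_getElem?, hx] at h4
      rw [Option.some.inj h4] at hxκ
      rw [hxκ] at hvu ⊢
      simpa using hvu
    · rw [if_neg hp] at h0 h1 h2
      rw [if_neg hp] at h1
      have hvu := hmate u hu v hv hLuv h0 h1 h2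
      have h4 := hS.getElem?_pos u hu
      rw [h0, ← List.head?_eq_getElem?, hLuv] at h4
      have h5 : κ u = true := by
        by_contra h5
        exact hp ⟨u, h4, by simpa using h5⟩
      rw [h5] at hvu ⊢
      simpa using hvu

end Layer

/-! ### The second layer: pairs of vertices sharing a color -/

section Outer

variable {V : Type*} {G : SimpleGraph V} {D : Finset V} {c : Sym2 V → Fin 3 ⊕ Fin 3}

theorem inl_mem_map_inl {α β : Type*} {C : Finset α} {x : α} :
    (Sum.inl x : α ⊕ β) ∈ C.map Function.Embedding.inl ↔ x ∈ C :=
  Finset.mem_map' Function.Embedding.inl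

theorem inr_notMem_map_inl {α β : Type*} {C : Finset α} {x : β} :
    (Sum.inr x : α ⊕ β) ∉ C.map Function.Embedding.inl := by
  simp [Function.Embedding.inl]

theorem disjoint_insert_inl {j₁ j₂ : Fin 3} {S₁ S₂ : Finset (Fin 3)} (hj : j₁ ≠ j₂)
    (hS : Disjoint S₁ S₂) :
    Disjoint (insert (Sum.inl j₁) (S₁.image Sum.inr) : Finset (Fin 3 ⊕ Fin 3))
      (insert (Sum.inl j₂) (S₂.image Sum.inr)) := by
  rw [Finset.disjoint_left] at hS ⊢
  intro x h1 h2
  simp only [Finset.mem_insert, Finset.mem_image] at h1 h2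
  rcases h1 with rfl | ⟨a, ha, rfl⟩ <;> rcases h2 with h2 | ⟨b, hb, h2⟩
  · exact hj (Sum.inl.inj h2)
  · cases h2
  · cases h2
  · cases h2
    exact hS ha hb

theorem inr_notMem_insert_inl {j y : Fin 3} {S : Finset (Fin 3)} (hy : y ∉ S) :
    (Sum.inr y : Fin 3 ⊕ Fin 3) ∉ insert (Sum.inl j : Fin 3 ⊕ Fin 3) (S.image Sum.inr) := by
  simpa using hy

theorem IsMidType.exists_isEndType {v : V} {g i : Fin 3} (h : IsMidType G D c v g i) :
    ∃ b, IsEndType G D c v b i := by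
  obtain ⟨b, hb⟩ := midInner_subset_endInner g i
  exact ⟨b, fun j => (h j).mono (hb j)⟩

/-- Three vertices can be attached by paths with disjoint sets of colors. -/
def DisjointlyAttachable {K : Type*} [DecidableEq K] (G : SimpleGraph V) (D : Finset V)
    (c : Sym2 V → K) (B : Finset K) (x y z : V) : Prop :=
  ∃ C₁ C₂ C₃ : Finset K, Disjoint C₁ C₂ ∧ Disjoint C₁ C₃ ∧ Disjoint C₂ C₃ ∧
    Attachable G D c x C₁ ∧ Attachable G D c y C₂ ∧ Attachable G D c z C₃ ∧
    Disjoint B C₁ ∧ Disjoint B C₂ ∧ Disjoint B C₃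

section

variable {K : Type*} [DecidableEq K] {c : Sym2 V → K} {B : Finset K} {x y z : V}

theorem DisjointlyAttachable.swap_left (h : DisjointlyAttachable G D c B x y z) :
    DisjointlyAttachable G D c B y x z := by
  obtain ⟨C₁, C₂, C₃, h1, h2, h3, h4, h5, h6, h7, h8, h9⟩ := h
  exact ⟨C₂, C₁, C₃, h1.symm, h3, h2, h5, h4, h6, h8, h7, h9⟩

theorem DisjointlyAttachable.swap_right (h : DisjointlyAttachable G D c B x y z) :
    DisjointlyAttachable G D c B x z y := by
  obtain ⟨C₁, C₂, C₃, h1, h2, h3, h4, h5, h6, h7, h8, h9⟩ := h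
  exact ⟨C₁, C₃, C₂, h2, h1, h3.symm, h4, h6, h5, h7, h9, h8⟩

end

theorem IsEndType.disjointlyAttachable {x y z : V} {b₁ b₂ b₃ : Bool} {i₁ i₂ i₃ : Fin 3}
    (hx : IsEndType G D c x b₁ i₁) (hy : IsEndType G D c y b₂ i₂) (hz : IsEndType G D c z b₃ i₃) :
    DisjointlyAttachable G D c ∅ x y z := by
  obtain ⟨j₁, j₂, j₃, h1, h2, h3, h4, h5, h6⟩ := exists_disjoint_endInner b₁ b₂ b₃ i₁ i₂ i₃
  exact ⟨_, _, _, disjoint_insert_inl h1 h4, disjoint_insert_inl h2 h5, disjoint_insert_inl h3 h6,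
    hx j₁, hy j₂, hz j₃, by simp, by simp, by simp⟩

theorem IsMidType.exists_disjointlyAttachable {x y : V} {g i₁ : Fin 3} {b₂ : Bool} {i₂ : Fin 3}
    (hx : IsMidType G D c x g i₁) (hy : IsEndType G D c y b₂ i₂) :
    ∃ a : Fin 3, ∀ z b₃ i₃, IsEndType G D c z b₃ i₃ →
      DisjointlyAttachable G D c {Sum.inr a} x y z := by
  obtain ⟨a, ha⟩ := exists_disjoint_midInner g i₁ b₂ i₂
  refine ⟨a, fun z b₃ i₃ hz => ?_⟩
  obtain ⟨j₁, j₂, j₃, h1, h2, h3, h4, h5, h6, h7, h8, h9⟩ := ha b₃ i₃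
  refine ⟨_, _, _, disjoint_insert_inl h1 h4, disjoint_insert_inl h2 h5, disjoint_insert_inl h3 h6,
    hx j₁, hy j₂, hz j₃, ?_, ?_, ?_⟩ <;> rw [Finset.disjoint_singleton_left] <;>
    exact inr_notMem_insert_inl ‹_›

theorem IsEndType.exists_disjointlyAttachable {x y : V} {i₁ i₂ : Fin 3}
    (hx : IsEndType G D c x true i₁) (hy : IsEndType G D c y false i₂) :
    ∃ a : Fin 3, ∀ z b₃ i₃, IsEndType G D c z b₃ i₃ →
      DisjointlyAttachable G D c {Sum.inr a} x y z := by
  obtain ⟨a, ha⟩ := exists_disjoint_endInner_true_false i₁ i₂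
  refine ⟨a, fun z b₃ i₃ hz => ?_⟩
  obtain ⟨j₁, j₂, j₃, h1, h2, h3, h4, h5, h6, h7, h8, h9⟩ := ha b₃ i₃
  refine ⟨_, _, _, disjoint_insert_inl h1 h4, disjoint_insert_inl h2 h5, disjoint_insert_inl h3 h6,
    hx j₁, hy j₂, hz j₃, ?_, ?_, ?_⟩ <;> rw [Finset.disjoint_singleton_left] <;>
    exact inr_notMem_insert_inl ‹_›

/-- A spare inner color exists as soon as one of the two vertices is an inner vertex or the two are
ends of opposite types. Only two ends of equal type are not covered, and `hb` excludes them. -/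
theorem exists_disjointlyAttachable_of_ne {x y : V} {b₁ b₂ : Bool} (hb : b₁ ≠ b₂)
    (hx : (∃ g i, IsMidType G D c x g i) ∨ ∃ i, IsEndType G D c x b₁ i)
    (hy : (∃ g i, IsMidType G D c y g i) ∨ ∃ i, IsEndType G D c y b₂ i) :
    ∃ a : Fin 3, ∀ z b₃ i₃, IsEndType G D c z b₃ i₃ →
      DisjointlyAttachable G D c {Sum.inr a} x y z := by
  rcases hx with ⟨g, i, hx⟩ | ⟨i, hx⟩ <;> rcases hy with ⟨g', i', hy⟩ | ⟨i', hy⟩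
  · obtain ⟨b, hy⟩ := hy.exists_isEndType
    exact hx.exists_disjointlyAttachable hy
  · exact hx.exists_disjointlyAttachable hy
  · obtain ⟨a, ha⟩ := hy.exists_disjointlyAttachable hx
    exact ⟨a, fun z b i h => (ha z b i h).swap_left⟩
  · cases b₁ <;> cases b₂
    · exact absurd rfl hb
    · obtain ⟨a, ha⟩ := hy.exists_disjointlyAttachable hx
      exact ⟨a, fun z b i h => (ha z b i h).swap_left⟩
    · exact hx.exists_disjointlyAttachable hy
    · exact absurd rfl hb

theorem exists_enumeration {V : Type*} [Nonempty V] (W : Finset V) :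
    ∃ (idx : V → ℕ) (a : ℕ → V), (∀ w ∈ W, idx w < W.card ∧ a (idx w) = w) ∧
      ∀ i < W.card, a i ∈ W ∧ idx (a i) = i := by
  classical
  let e := W.equivFin
  refine ⟨fun w => if h : w ∈ W then (e ⟨w, h⟩).val else 0,
    fun i => if h : i < W.card then (e.symm ⟨i, h⟩).val else Classical.arbitrary V, ?_, ?_⟩
  · intro w hw
    simp [hw]
  · intro i hi
    simp [hi]

/-- Vertices `2j` and `2j + 1` in an enumeration of `W` are partners and share the new color `j`. By
`hN1` the chosen neighbors `r w` are distinct, so the pairs of these neighbors form a matching,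
which is made compatible with that of the path ends. The second neighbor `s w` gives the odd partner
a route starting with the shared color when its partner is not in the triple. -/
theorem rainbowIndex_le_of_two_layers [Fintype V] {N W : Finset V}
    (hD : (G.induce (D : Set V)).Connected) (hcov : ∀ v, v ∈ D ∨ v ∈ N ∨ v ∈ W)
    (hDN : ∀ v ∈ N, v ∉ D) (hDW : ∀ v ∈ W, v ∉ D) (hNW : ∀ v ∈ W, v ∉ N)
    (hd : ∀ v ∈ N, ∃ d ∈ D, G.Adj v d)
    (h3 : ∀ v ∈ N, ∀ p q, ∃ y, (y ∈ D ∨ y ∈ N) ∧ G.Adj v y ∧ y ≠ p ∧ y ≠ q)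
    (hN1 : ∀ u ∈ N, ∀ w ∈ W, ∀ w' ∈ W, G.Adj w u → G.Adj w' u → w = w')
    (hW2 : ∀ w ∈ W, ∃ r ∈ N, ∃ s ∈ N, r ≠ s ∧ G.Adj w r ∧ G.Adj w s) :
    rainbowIndex 3 G + 1 ≤ D.card + (6 + (W.card + 1) / 2) := by
  classical
  have hne : Nonempty V := hD.nonempty.map Subtype.val
  obtain ⟨idx, enum, hidx, henum⟩ := exists_enumeration W
  choose! r hrN s hsN hrs hwr hws using hW2
  have hrinj : ∀ w ∈ W, ∀ w' ∈ W, r w = r w' → w = w' := fun w hw w' hw' h =>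
    hN1 (r w) (hrN w hw) w hw w' hw' (hwr w hw) (h ▸ hwr w' hw')
  -- the edges outside `W`
  let G₀ : SimpleGraph V :=
    { Adj := fun u v => G.Adj u v ∧ u ∉ W ∧ v ∉ W
      symm := ⟨fun _ _ h => ⟨h.1.symm, h.2.2, h.2.1⟩⟩
      loopless := ⟨fun _ h => h.1.ne rfl⟩ }
  have hDW' : ∀ v ∈ D, v ∉ W := fun v hv h => hDW v h hv
  have hNW' : ∀ v ∈ N, v ∉ W := fun v hv h => hNW v h hv
  obtain ⟨mate, hmate, hcol⟩ := exists_mate_coloring (G := G₀) (D := D) (N := N) hDN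
    (fun v hv => (hd v hv).imp fun d h => ⟨h.1, h.2, hNW' v hv, hDW' d h.1⟩)
    (fun v hv p q => (h3 v hv p q).imp fun y h =>
      ⟨h.1, ⟨h.2.1, hNW' v hv, h.1.elim (hDW' y) (hNW' y)⟩, h.2.2⟩)
  obtain ⟨κ, hκ, hκps⟩ := exists_bool_coloring_of_involutive
    ((List.range (W.card / 2)).map fun j => (r (enum (2 * j)), r (enum (2 * j + 1)))) mate hmate
    (by
      intro x hx
      obtain ⟨j, hj, rfl⟩ := List.mem_map.mp hx
      rw [List.mem_range] at hj
      have h1 := henum (2 * j) (by omega)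
      have h2 := henum (2 * j + 1) (by omega)
      intro h
      have := congrArg idx (hrinj _ h1.1 _ h2.1 h)
      omega)
    (by
      rw [List.pairwise_map]
      refine List.Pairwise.imp_of_mem ?_ List.pairwise_lt_range
      intro j k hj hk hjk
      rw [List.mem_range] at hj hk
      have h1 := henum (2 * j) (by omega)
      have h2 := henum (2 * j + 1) (by omega)
      have h1' := henum (2 * k) (by omega)
      have h2' := henum (2 * k + 1) (by omega)
      refine ⟨fun h => ?_, fun h => ?_, fun h => ?_, fun h => ?_⟩
      · have := congrArg idx (hrinj _ h1.1 _ h1'.1 h)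
        omega
      · have := congrArg idx (hrinj _ h1.1 _ h2'.1 h)
        omega
      · have := congrArg idx (hrinj _ h2.1 _ h1'.1 h)
        omega
      · have := congrArg idx (hrinj _ h2.1 _ h2'.1 h)
        omega)
  obtain ⟨c₀, hc₀⟩ := hcol κ hκ
  have hend : ∀ v, v ∉ W → ∃ b i, IsEndType G₀ D c₀ v b i := by
    intro v hv
    rcases hcov v with h | h | h
    -- A vertex of `D` needs no path, so any type is correct for it.
    · exact ⟨true, 0, fun j => .base h⟩
    · rcases hc₀ v h with ⟨g, i, h⟩ | ⟨i, h⟩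
      · exact h.exists_isEndType.imp fun b hb => ⟨i, hb⟩
      · exact ⟨_, i, h⟩
    · exact absurd h hv
  -- the partner colors
  have hy : ∀ w' ∈ W, ∃ y : Fin 3, ∀ w ∈ W, idx w % 2 = 0 → idx w' = idx w + 1 →
      ∀ x, x ∉ W → DisjointlyAttachable G₀ D c₀ {Sum.inr y} (r w) (r w') x := by
    intro w' hw'
    by_cases h : ∃ w ∈ W, idx w % 2 = 0 ∧ idx w' = idx w + 1
    · obtain ⟨w, hw, h1, h2⟩ := h
      have hb : κ (r w) ≠ κ (r w') := by
        refine hκps (r w, r w') (List.mem_map.mpr ⟨idx w / 2, ?_, ?_⟩)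
        · rw [List.mem_range]
          have := (hidx w' hw').1
          omega
        · rw [show 2 * (idx w / 2) = idx w by omega, ← h2, (hidx w hw).2, (hidx w' hw').2]
      obtain ⟨a, ha⟩ := exists_disjointlyAttachable_of_ne hb (hc₀ _ (hrN w hw)) (hc₀ _ (hrN w' hw'))
      refine ⟨a, fun v hv h3 h4 x hx => ?_⟩
      have hvw : v = w := by
        rw [← (hidx v hv).2, ← (hidx w hw).2]
        congr 1
        omega
      rw [hvw]
      obtain ⟨b, i, hbi⟩ := hend x hx
      exact ha x b i hbi
    · exact ⟨0, fun w hw h1 h2 => absurd ⟨w, hw, h1, h2⟩ h⟩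
  choose! y hy using hy
  -- the coloring
  let K := (Fin 3 ⊕ Fin 3) ⊕ Fin ((W.card + 1) / 2)
  have hz : ∀ w ∈ W, ∃ z : Fin ((W.card + 1) / 2), z.val = idx w / 2 := fun w hw =>
    ⟨⟨idx w / 2, by have := (hidx w hw).1; omega⟩, rfl⟩
  have hz' : ∃ z : V → K, ∀ w ∈ W, ∃ z' : Fin ((W.card + 1) / 2), z'.val = idx w / 2 ∧
      z w = Sum.inr z' := by
    choose z hz using hz
    exact ⟨fun w => if h : w ∈ W then Sum.inr (z w h) else Sum.inl (Sum.inl 0), fun w hw =>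
      ⟨z w hw, hz w hw, by simp [hw]⟩⟩
  obtain ⟨z, hz⟩ := hz'
  -- At an odd partner `w`, only the edge to `r w` gets the inner color `y w`; all other edges from
  -- `W` to its complement get the color of the pair. Edges within `W` are never used.
  obtain ⟨c₁, hc₁⟩ := exists_sym2_coloring (fun w u => w ∈ W ∧ u ∉ W)
    (fun w u => if idx w % 2 = 1 ∧ u = r w then Sum.inl (Sum.inr (y w)) else z w)
    (fun u v h h' => h'.2 h.1)
  let c : Sym2 V → K := fun e => if ∃ w ∈ W, w ∈ e then c₁ e else Sum.inl (c₀ e)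
  have hcW : ∀ w ∈ W, ∀ u, u ∉ W → c s(w, u) =
      if idx w % 2 = 1 ∧ u = r w then Sum.inl (Sum.inr (y w)) else z w := by
    intro w hw u hu
    simp only [c]
    rw [if_pos ⟨w, hw, by simp⟩]
    exact hc₁ w u ⟨hw, hu⟩
  have hlift : ∀ v (C : Finset (Fin 3 ⊕ Fin 3)), Attachable G₀ D c₀ v C →
      Attachable G D c v (C.map Function.Embedding.inl) := by
    intro v C h
    refine Attachable.map (G' := G) (c' := c) _ (fun a b (h : G₀.Adj a b) => h.1) ?_ h
    intro a b hab _
    simp only [c]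
    rw [if_neg]
    · rfl
    · rintro ⟨w, hw, hwe⟩
      rcases Sym2.mem_iff.mp hwe with rfl | rfl
      · exact hab.2.1 hw
      · exact hab.2.2 hw
  -- The regular entry vertex, reached by an edge of the color of the pair: `s v` for odd partners,
  -- since their edge to `r v` has the exceptional color.
  let ρ : V → V := fun v => if v ∈ W then (if idx v % 2 = 1 then s v else r v) else v
  let X : V → Finset K := fun v => if v ∈ W then {z v} else ∅
  have hρW : ∀ v, ρ v ∉ W := by
    intro v
    simp only [ρ]
    split_ifs with h1 h2
    · exact hNW' _ (hsN v h1)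
    · exact hNW' _ (hrN v h1)
    · exact h1
  have hXinl : ∀ v (C : Finset (Fin 3 ⊕ Fin 3)), Disjoint (X v) (C.map Function.Embedding.inl) := by
    intro v C
    simp only [X]
    split_ifs with h
    · obtain ⟨z', -, h2⟩ := hz v h
      rw [Finset.disjoint_singleton_left, h2]
      exact inr_notMem_map_inl
    · simp
  have hroute : ∀ v (C : Finset (Fin 3 ⊕ Fin 3)), Attachable G₀ D c₀ (ρ v) C →
      Attachable G D c v (X v ∪ C.map Function.Embedding.inl) := by
    intro v C h
    have h' := hlift _ _ h
    by_cases hv : v ∈ W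
    · have hX : X v = {z v} := by simp only [X, hv, if_true]
      have h2 := hXinl v C
      rw [hX, Finset.disjoint_singleton_left] at h2
      rw [hX, ← Finset.insert_eq]
      refine Attachable.insert (hDW v hv) ?_ ?_ h2 h'
      · simp only [ρ, hv, if_true]
        split_ifs
        · exact hws v hv
        · exact hwr v hv
      · rw [hcW v hv _ (hρW v), if_neg]
        rintro ⟨h4, h5⟩
        simp only [ρ, hv, h4, if_true] at h5
        exact hrs v hv h5.symm
    · simpa only [ρ, X, hv, if_false, Finset.empty_union] using h'
  have hXX : ∀ v v', ¬ (v ∈ W ∧ v' ∈ W ∧ idx v / 2 = idx v' / 2) → Disjoint (X v) (X v') := by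
    intro v v' h
    simp only [X]
    by_cases hv : v ∈ W <;> by_cases hv' : v' ∈ W <;> simp only [hv, hv', if_true, if_false] <;>
      try simp
    obtain ⟨a, h1, h2⟩ := hz v hv
    obtain ⟨b, h1', h2'⟩ := hz v' hv'
    rw [h2, h2']
    intro h4
    rw [Sum.inr.inj h4] at h1
    exact h ⟨hv, hv', h1.symm.trans h1'⟩
  have hunion : ∀ v v' (C C' : Finset (Fin 3 ⊕ Fin 3)), Disjoint (X v) (X v') → Disjoint C C' →
      Disjoint (X v ∪ C.map Function.Embedding.inl) (X v' ∪ C'.map Function.Embedding.inl) := by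
    intro v v' C C' h1 h2
    rw [Finset.disjoint_union_left, Finset.disjoint_union_right, Finset.disjoint_union_right]
    exact ⟨⟨h1, hXinl _ _⟩, (hXinl _ _).symm, (Finset.disjoint_map _).mpr h2⟩
  -- triples with two partners
  have hpair : ∀ w ∈ W, ∀ w' ∈ W, ∀ x, x ≠ w → x ≠ w' → idx w % 2 = 0 → idx w' = idx w + 1 →
      DisjointlyAttachable G D c ∅ w w' x := by
    intro w hw w' hw' x hxw hxw' h1 h2
    -- Here `w` enters at `r w` with the shared color and `w'` at `r w'` with the spare inner color;
    -- the third vertex takes its regular route.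
    obtain ⟨C₁, C₂, C₃, d12, d13, d23, a1, a2, a3, y1, y2, y3⟩ := hy w' hw' w hw h1 h2 (ρ x) (hρW x)
    have hρ : ρ w = r w := by
      simp only [ρ, hw, if_true]
      rw [if_neg (by omega)]
    have hwx : Disjoint (X w) (X x) := by
      refine hXX _ _ ?_
      rintro ⟨-, hx, h4⟩
      rcases (by omega : idx x = idx w ∨ idx x = idx w') with h5 | h5
      · exact hxw (by rw [← (hidx x hx).2, h5, (hidx w hw).2])
      · exact hxw' (by rw [← (hidx x hx).2, h5, (hidx w' hw').2])
    rw [Finset.disjoint_singleton_left] at y1 y2 y3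
    have hymap : ∀ v (C : Finset (Fin 3 ⊕ Fin 3)), Sum.inr (y w') ∉ C →
        (Sum.inl (Sum.inr (y w')) : K) ∉ X v ∪ C.map Function.Embedding.inl := by
      intro v C hC
      rw [Finset.mem_union, not_or]
      constructor
      · have := hXinl v {Sum.inr (y w')}
        rwa [Finset.map_singleton, Finset.disjoint_singleton_right] at this
      · rwa [inl_mem_map_inl]
    have a2' : Attachable G D c w'
        (insert (Sum.inl (Sum.inr (y w'))) (C₂.map Function.Embedding.inl)) := by
      refine Attachable.insert (hDW w' hw') (hwr w' hw') ?_ (by rwa [inl_mem_map_inl]) (hlift _ _ a2)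
      rw [hcW w' hw' _ (hNW' _ (hrN w' hw')), if_pos ⟨by omega, rfl⟩]
    refine ⟨_, _, _, ?_, hunion w x C₁ C₃ hwx d13, ?_, hroute w C₁ (hρ ▸ a1), a2', hroute x C₃ a3,
      by simp, by simp, by simp⟩
    · rw [Finset.disjoint_insert_right]
      refine ⟨hymap _ _ y1, ?_⟩
      rw [Finset.disjoint_union_left]
      exact ⟨hXinl _ _, (Finset.disjoint_map _).mpr d12⟩
    · rw [Finset.disjoint_insert_left]
      refine ⟨hymap _ _ y3, ?_⟩
      rw [Finset.disjoint_union_right]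
      exact ⟨(hXinl _ _).symm, (Finset.disjoint_map _).mpr d23⟩
  have hpair' : ∀ w w' x, x ≠ w → x ≠ w' → w ≠ w' → w ∈ W ∧ w' ∈ W ∧ idx w / 2 = idx w' / 2 →
      DisjointlyAttachable G D c ∅ w w' x := by
    rintro w w' x h1 h2 h4 ⟨hw, hw', h5⟩
    have h6 : idx w ≠ idx w' := fun h => h4 (by rw [← (hidx w hw).2, h, (hidx w' hw').2])
    rcases Nat.mod_two_eq_zero_or_one (idx w) with h7 | h7
    · exact hpair w hw w' hw' x h1 h2 h7 (by omega)
    · exact (hpair w' hw' w hw x h2 h1 (by omega) (by omega)).swap_left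
  have hall : ∀ x₁ x₂ x₃ : V, x₁ ≠ x₂ → x₁ ≠ x₃ → x₂ ≠ x₃ →
      DisjointlyAttachable G D c ∅ x₁ x₂ x₃ := by
    intro x₁ x₂ x₃ n12 n13 n23
    by_cases p12 : x₁ ∈ W ∧ x₂ ∈ W ∧ idx x₁ / 2 = idx x₂ / 2
    · exact hpair' _ _ _ n13.symm n23.symm n12 p12
    by_cases p13 : x₁ ∈ W ∧ x₃ ∈ W ∧ idx x₁ / 2 = idx x₃ / 2
    · exact (hpair' _ _ _ n12.symm n23 n13 p13).swap_right
    by_cases p23 : x₂ ∈ W ∧ x₃ ∈ W ∧ idx x₂ / 2 = idx x₃ / 2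
    · exact (hpair' _ _ _ n12 n13 n23 p23).swap_right.swap_left
    obtain ⟨b₁, i₁, e1⟩ := hend _ (hρW x₁)
    obtain ⟨b₂, i₂, e2⟩ := hend _ (hρW x₂)
    obtain ⟨b₃, i₃, e3⟩ := hend _ (hρW x₃)
    obtain ⟨C₁, C₂, C₃, d12, d13, d23, a1, a2, a3, -, -, -⟩ := e1.disjointlyAttachable e2 e3
    exact ⟨_, _, _, hunion x₁ x₂ C₁ C₂ (hXX _ _ p12) d12, hunion x₁ x₃ C₁ C₃ (hXX _ _ p13) d13,
      hunion x₂ x₃ C₂ C₃ (hXX _ _ p23) d23, hroute _ _ a1, hroute _ _ a2, hroute _ _ a3,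
      by simp, by simp, by simp⟩
  have hK : Fintype.card K = 6 + (W.card + 1) / 2 := by
    simp [K]
  rw [← hK]
  refine rainbowIndex_le_of_attachable hD (c := c) fun x₁ x₂ x₃ n12 n13 n23 => ?_
  obtain ⟨C₁, C₂, C₃, h1, h2, h4, h5, h6, h7, -⟩ := hall x₁ x₂ x₃ n12 n13 n23
  exact ⟨C₁, C₂, C₃, h1, h2, h4, h5, h6, h7⟩

end Outer

/-! ### Selecting the connected set by a potential -/

theorem exists_adj_outside {V : Type*} {G : SimpleGraph V} (hG : G.Connected)
    {S : Finset V} (hS : S.Nonempty)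
    (hS' : ∃ v, v ∉ S) : ∃ x ∈ S, ∃ y, y ∉ S ∧ G.Adj x y := by
  obtain ⟨a, ha⟩ := hS
  obtain ⟨b, hb⟩ := hS'
  obtain ⟨p⟩ := hG a b
  obtain ⟨d, -, h1, h2⟩ := p.exists_boundary_dart (S : Set V) ha hb
  exact ⟨d.fst, h1, d.snd, h2, d.adj⟩

theorem connected_induce_singleton {V : Type*} {G : SimpleGraph V} (v : V) :
    (G.induce (({v} : Finset V) : Set V)).Connected := by
  rw [Finset.coe_singleton]
  have : Subsingleton ({v} : Set V) := inferInstance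
  have : Nonempty ({v} : Set V) := ⟨⟨v, rfl⟩⟩
  exact ⟨Preconnected.of_subsingleton⟩

/-- The second criterion `g` will be the number of vertices outside: an enlargement of `D` that does
not increase the potential but covers more vertices is already a contradiction. -/
theorem exists_lexicographic_min {α : Type*} [Finite α] (p : α → Prop) (f : α → ℤ) (g : α → ℕ)
    {a₀ : α} (h₀ : p a₀) : ∃ a, p a ∧ f a ≤ f a₀ ∧ ∀ b, p b → f b ≤ f a → g a ≤ g b := by
  classical
  have := Fintype.ofFinite α
  obtain ⟨a, ha, hmin⟩ := Finset.exists_min_image (Finset.univ.filter p) f ⟨a₀, by simpa using h₀⟩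
  obtain ⟨b, hb, hmin'⟩ := Finset.exists_min_image
    (Finset.univ.filter fun b => p b ∧ f b ≤ f a) g ⟨a, by simpa using ha⟩
  simp only [Finset.mem_filter, Finset.mem_univ, true_and] at ha hmin hb hmin'
  exact ⟨b, hb.1, hb.2.trans (hmin a₀ h₀), fun c hc hcb => hmin' c ⟨hc, hcb.trans hb.2⟩⟩

section Layers

variable {V : Type*} [Fintype V] [DecidableEq V] (G : SimpleGraph V) [DecidableRel G.Adj]
  (D : Finset V)

/-- The vertices at distance one from `D`. -/
def firstLayer : Finset V := {v | v ∉ D ∧ ∃ d ∈ D, G.Adj v d}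

/-- The vertices at distance at least two from `D`. -/
def outside : Finset V := {v | v ∉ D ∧ ∀ d ∈ D, ¬ G.Adj v d}

/-- The vertices at distance one from `D` that have no neighbor at distance two. -/
def deadLayer : Finset V := {v ∈ G.firstLayer D | ∀ w ∈ G.outside D, ¬ G.Adj v w}

variable {G D} {u v w : V}

theorem mem_firstLayer : v ∈ G.firstLayer D ↔ v ∉ D ∧ ∃ d ∈ D, G.Adj v d := by
  simp [firstLayer]

theorem mem_outside : v ∈ G.outside D ↔ v ∉ D ∧ ∀ d ∈ D, ¬ G.Adj v d := by
  simp [outside]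

theorem mem_deadLayer :
    v ∈ G.deadLayer D ↔ v ∈ G.firstLayer D ∧ ∀ w ∈ G.outside D, ¬ G.Adj v w := by
  simp [deadLayer]

theorem mem_or_mem_firstLayer_or_mem_outside (G : SimpleGraph V) [DecidableRel G.Adj]
    (D : Finset V) (v : V) : v ∈ D ∨ v ∈ G.firstLayer D ∨ v ∈ G.outside D := by
  simp only [mem_firstLayer, mem_outside]
  grind

theorem notMem_outside_of_mem_firstLayer (h : v ∈ G.firstLayer D) : v ∉ G.outside D := by
  simp only [mem_firstLayer, mem_outside] at *
  grind

theorem card_layers (G : SimpleGraph V) [DecidableRel G.Adj] (D : Finset V) :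
    D.card + (G.firstLayer D).card + (G.outside D).card = Fintype.card V := by
  have h1 : Disjoint D (G.firstLayer D) := Finset.disjoint_right.mpr fun v hv =>
    (mem_firstLayer.mp hv).1
  have h2 : Disjoint (D ∪ G.firstLayer D) (G.outside D) := by
    rw [Finset.disjoint_left]
    intro v hv
    rcases Finset.mem_union.mp hv with hv | hv
    · exact fun h => (mem_outside.mp h).1 hv
    · exact notMem_outside_of_mem_firstLayer hv
  rw [← Finset.card_union_of_disjoint h1, ← Finset.card_union_of_disjoint h2,
    ← Finset.card_univ]
  congr 1
  ext v
  have := mem_or_mem_firstLayer_or_mem_outside G D v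
  simpa [or_assoc] using this

theorem mem_outside_insert :
    w ∈ G.outside (insert u D) ↔ w ∈ G.outside D ∧ w ≠ u ∧ ¬ G.Adj u w := by
  simp only [mem_outside, Finset.mem_insert, G.adj_comm u w]
  grind

theorem outside_insert_subset : G.outside (insert u D) ⊆ G.outside D := fun _ h =>
  (mem_outside_insert.mp h).1

theorem card_outside_insert (hu : u ∈ G.firstLayer D) :
    (G.outside (insert u D)).card + ((G.outside D).filter (G.Adj u)).card =
      (G.outside D).card := by
  rw [← Finset.card_filter_add_card_filter_not (s := G.outside D) (G.Adj u), add_comm]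
  congr 2
  ext w
  rw [mem_outside_insert, Finset.mem_filter]
  have := notMem_outside_of_mem_firstLayer hu
  grind

theorem connected_induce_insert (hD : (G.induce (D : Set V)).Connected)
    (hu : u ∈ G.firstLayer D) : (G.induce ((insert u D : Finset V) : Set V)).Connected := by
  obtain ⟨-, d, hd, hud⟩ := mem_firstLayer.mp hu
  have h1 : (G.induce {u, d}).Connected := induce_pair_connected_of_adj hud
  have h2 := induce_union_connected h1.preconnected hD.preconnected ⟨d, by simp, hd⟩
  have h3 : ((insert u D : Finset V) : Set V) = {u, d} ∪ (D : Set V) := by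
    ext x
    simp only [Finset.coe_insert, Set.mem_insert_iff, Finset.mem_coe, Set.mem_union,
      Set.mem_singleton_iff]
    grind
  rwa [h3]

theorem deadLayer_subset_insert (hu : u ∉ G.deadLayer D) :
    G.deadLayer D ⊆ G.deadLayer (insert u D) := by
  intro v hv
  have h1 := mem_deadLayer.mp hv
  have h2 := mem_firstLayer.mp h1.1
  refine mem_deadLayer.mpr ⟨mem_firstLayer.mpr ⟨?_, ?_⟩, fun w hw =>
    h1.2 w (outside_insert_subset hw)⟩
  · rw [Finset.mem_insert, not_or]
    exact ⟨fun h => hu (h ▸ hv), h2.1⟩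
  · obtain ⟨d, hd, hvd⟩ := h2.2
    exact ⟨d, Finset.mem_insert_of_mem hd, hvd⟩

theorem mem_firstLayer_insert_of_mem_outside (hw : w ∈ G.outside D) (h : G.Adj u w) :
    w ∈ G.firstLayer (insert u D) :=
  mem_firstLayer.mpr ⟨fun h' => by
    rcases Finset.mem_insert.mp h' with rfl | h'
    · exact h.ne rfl
    · exact (mem_outside.mp hw).1 h', u, by simp, h.symm⟩

theorem card_firstLayer_singleton (v : V) : (G.firstLayer {v}).card = G.degree v := by
  rw [← card_neighborFinset_eq_degree]
  congr 1
  ext w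
  simp only [mem_firstLayer, Finset.mem_singleton, mem_neighborFinset, exists_eq_left]
  exact ⟨fun h => h.2.symm, fun h => ⟨h.ne', h.symm⟩⟩

end Layers

section Selection

variable {V : Type*} [Fintype V] [DecidableEq V] {G : SimpleGraph V} [DecidableRel G.Adj]

theorem card_outside_singleton (v : V) :
    (G.outside {v}).card + G.degree v + 1 = Fintype.card V := by
  have := card_layers G {v}
  rw [card_firstLayer_singleton, Finset.card_singleton] at this
  omega

theorem eq_of_card_filter_lt_two {D : Finset V} {u w w' : V}
    (h : ((G.outside D).filter (G.Adj u)).card < 2) (hw : w ∈ G.outside D) (hw' : w' ∈ G.outside D)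
    (h1 : G.Adj u w) (h2 : G.Adj u w') : w = w' :=
  Finset.card_le_one.mp (Nat.lt_succ_iff.mp h) w (Finset.mem_filter.mpr ⟨hw, h1⟩) w'
    (Finset.mem_filter.mpr ⟨hw', h2⟩)

theorem degree_eq_of_mem_outside {D : Finset V} {w : V} (hw : w ∈ G.outside D) :
    ((G.firstLayer D).filter (G.Adj w)).card + ((G.outside D).filter (G.Adj w)).card =
      G.degree w := by
  rw [← card_neighborFinset_eq_degree, ← Finset.card_union_of_disjoint]
  · congr 1
    ext x
    simp only [Finset.mem_union, Finset.mem_filter, mem_neighborFinset]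
    have := mem_or_mem_firstLayer_or_mem_outside G D x
    have h2 := (mem_outside.mp hw).2 x
    tauto
  · rw [Finset.disjoint_left]
    intro x hx hx'
    exact notMem_outside_of_mem_firstLayer (Finset.mem_filter.mp hx).1 (Finset.mem_filter.mp hx').1

/-- A connected set of vertices that has no vertex at distance more than two, and such that the
vertices at distance two have at least two neighbors at distance one, whereas the latter have at
most one of the former as neighbors. -/
theorem exists_connected_of_degree (hG : G.Connected) {k : ℕ} (h4 : 4 ≤ k) (h6 : k ≤ 6)
    (hδ : ∀ v, k ≤ G.degree v + 1) (v₀ : V) :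
    ∃ D : Finset V, (G.induce (D : Set V)).Connected ∧
      3 * (G.outside D).card + k * D.card ≤ 3 * (G.outside {v₀}).card + k ∧
      (∀ u ∈ G.firstLayer D, ((G.outside D).filter (G.Adj u)).card < 2) ∧
      ∀ w ∈ G.outside D, 2 ≤ ((G.firstLayer D).filter (G.Adj w)).card := by
  obtain ⟨D, hD, hD0, hmin⟩ := exists_lexicographic_min
    (fun D : Finset V => (G.induce (D : Set V)).Connected)
    (fun D => ((3 * (G.outside D).card + k * D.card : ℕ) : ℤ)) (fun D => (G.outside D).card)
    (connected_induce_singleton v₀)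
  have hmin' : ∀ D' : Finset V, (G.induce (D' : Set V)).Connected →
      3 * (G.outside D').card + k * D'.card ≤ 3 * (G.outside D).card + k * D.card →
      (G.outside D).card ≤ (G.outside D').card := fun D' h1 h2 => hmin D' h1 (by exact_mod_cast h2)
  -- Adding a vertex with two neighbors outside changes the potential by at most `k - 6 ≤ 0`.
  have hone : ∀ u ∈ G.firstLayer D, ((G.outside D).filter (G.Adj u)).card < 2 := by
    intro u hu
    by_contra! h2
    have h3 := card_outside_insert hu
    have h5 := hmin' _ (connected_induce_insert hD hu) (by
      rw [Finset.card_insert_of_notMem (mem_firstLayer.mp hu).1, mul_add]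
      omega)
    omega
  -- Otherwise some `x` at distance three is joined to `D` by a path through `y` and `u`. Adding all
  -- three costs `3k`, and covers `x` with all its neighbors, which are at least `k` vertices
  -- outside.
  have hpos : ∀ w ∈ G.outside D, 1 ≤ ((G.firstLayer D).filter (G.Adj w)).card := by
    by_contra! h
    let S := (G.outside D).filter fun w => ((G.firstLayer D).filter (G.Adj w)).card < 1
    obtain ⟨w, hw, hw1⟩ := h
    obtain ⟨d, hd⟩ := hD.nonempty
    obtain ⟨x, hx, y, hy, hxy⟩ := exists_adj_outside hG (S := S)
      ⟨w, Finset.mem_filter.mpr ⟨hw, hw1⟩⟩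
      ⟨d, fun h => (mem_outside.mp (Finset.mem_filter.mp h).1).1 hd⟩
    obtain ⟨hxW, hx1⟩ := Finset.mem_filter.mp hx
    have hxN : ∀ z ∈ G.firstLayer D, ¬ G.Adj x z := by
      rw [Nat.lt_one_iff, Finset.card_eq_zero, Finset.filter_eq_empty_iff] at hx1
      exact fun z hz => hx1 hz
    have hyW : y ∈ G.outside D := by
      rcases mem_or_mem_firstLayer_or_mem_outside G D y with h | h | h
      · exact absurd hxy ((mem_outside.mp hxW).2 y h)
      · exact absurd hxy (hxN y h)
      · exact h
    have hyN : ((G.firstLayer D).filter (G.Adj y)).Nonempty := by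
      rw [← Finset.card_pos]
      by_contra h
      exact hy (Finset.mem_filter.mpr ⟨hyW, by omega⟩)
    obtain ⟨u, hu⟩ := hyN
    obtain ⟨hu, hyu⟩ := Finset.mem_filter.mp hu
    have hyL := mem_firstLayer_insert_of_mem_outside hyW hyu.symm
    have hx2 : x ∈ G.outside (insert u D) := by
      refine mem_outside_insert.mpr ⟨hxW, ?_, fun h => hxN u hu h.symm⟩
      rintro rfl
      exact notMem_outside_of_mem_firstLayer hu hxW
    have hxL := mem_firstLayer_insert_of_mem_outside hx2 hxy.symm
    have hsub : insert x (G.neighborFinset x) ⊆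
        G.outside D \ G.outside (insert x (insert y (insert u D))) := by
      intro z hz
      rw [Finset.mem_sdiff, mem_outside_insert]
      rcases Finset.mem_insert.mp hz with rfl | hz
      · exact ⟨hxW, fun h => h.2.1 rfl⟩
      · rw [mem_neighborFinset] at hz
        refine ⟨?_, fun h => h.2.2 hz⟩
        rcases mem_or_mem_firstLayer_or_mem_outside G D z with h | h | h
        · exact absurd hz ((mem_outside.mp hxW).2 z h)
        · exact absurd hz (hxN z h)
        · exact h
    have hcard := Finset.card_le_card hsub
    have hss : G.outside (insert x (insert y (insert u D))) ⊆ G.outside D :=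
      outside_insert_subset.trans (outside_insert_subset.trans outside_insert_subset)
    rw [Finset.card_sdiff_of_subset hss, Finset.card_insert_of_notMem (by simp),
      card_neighborFinset_eq_degree] at hcard
    have := hδ x
    have h7 := hmin' _ (connected_induce_insert (connected_induce_insert
      (connected_induce_insert hD hu) hyL) hxL) (by
      rw [Finset.card_insert_of_notMem (mem_firstLayer.mp hxL).1,
        Finset.card_insert_of_notMem (mem_firstLayer.mp hyL).1,
        Finset.card_insert_of_notMem (mem_firstLayer.mp hu).1, mul_add, mul_add, mul_add]
      omega)
    omega
  have hD0' : 3 * (G.outside D).card + k * D.card ≤ 3 * (G.outside {v₀}).card + k := by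
    rw [Nat.cast_le, Finset.card_singleton, mul_one] at hD0
    exact hD0
  refine ⟨D, hD, hD0', hone, ?_⟩
  intro w hw
  -- If `u` is the only neighbor of `w` in the first layer, adding `u` and `w` costs `2k` and covers
  -- `w` and its remaining neighbors, at least `k - 1` vertices. By `hone`, none of the latter is
  -- covered by `u` already.
  by_contra! hlt
  have h1 := hpos w hw
  obtain ⟨u, hu⟩ := Finset.card_pos.mp h1
  obtain ⟨hu, hwu⟩ := Finset.mem_filter.mp hu
  have hwL := mem_firstLayer_insert_of_mem_outside hw hwu.symm
  have h2 : ((G.outside D).filter (G.Adj u)).card = 1 := by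
    have := hone u hu
    have : 0 < ((G.outside D).filter (G.Adj u)).card :=
      Finset.card_pos.mpr ⟨w, Finset.mem_filter.mpr ⟨hw, hwu.symm⟩⟩
    omega
  have h3 := card_outside_insert hu
  have h5 := card_outside_insert hwL
  have h7 : (G.outside D).filter (G.Adj w) ⊆ (G.outside (insert u D)).filter (G.Adj w) := by
    intro z hz
    obtain ⟨hz, hwz⟩ := Finset.mem_filter.mp hz
    refine Finset.mem_filter.mpr ⟨mem_outside_insert.mpr ⟨hz, ?_, fun huz => ?_⟩, hwz⟩
    · rintro rfl
      exact notMem_outside_of_mem_firstLayer hu hz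
    · exact hwz.ne (eq_of_card_filter_lt_two (hone u hu) hw hz hwu.symm huz)
  have h8 := Finset.card_le_card h7
  have h9 := degree_eq_of_mem_outside hw
  have h10 := hδ w
  have h11 := hmin' _ (connected_induce_insert (connected_induce_insert hD hu) hwL) (by
    rw [Finset.card_insert_of_notMem (mem_firstLayer.mp hwL).1,
      Finset.card_insert_of_notMem (mem_firstLayer.mp hu).1, mul_add, mul_add]
    omega)
  omega

theorem deadLayer_union_subset {D : Finset V} {u : V} (hu : u ∉ G.deadLayer D)
    (h : G.outside (insert u D) = ∅) :
    G.deadLayer D ∪ (G.outside D).filter (G.Adj u) ⊆ G.deadLayer (insert u D) := by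
  refine Finset.union_subset (deadLayer_subset_insert hu) fun w hw => ?_
  obtain ⟨hw, huw⟩ := Finset.mem_filter.mp hw
  exact mem_deadLayer.mpr ⟨mem_firstLayer_insert_of_mem_outside hw huw, by simp [h]⟩

theorem card_deadLayer_add_le {D : Finset V} {u : V} (hu : u ∉ G.deadLayer D)
    (h : G.outside (insert u D) = ∅) :
    (G.deadLayer D).card + ((G.outside D).filter (G.Adj u)).card ≤
      (G.deadLayer (insert u D)).card := by
  rw [← Finset.card_union_of_disjoint]
  · exact Finset.card_le_card (deadLayer_union_subset hu h)
  · rw [Finset.disjoint_left]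
    intro x hx hx'
    exact notMem_outside_of_mem_firstLayer (mem_deadLayer.mp hx).1 (Finset.mem_filter.mp hx').1

/-- Connected dominating sets in graphs of minimum degree at least three. -/
theorem exists_connected_dominating (hG : G.Connected) (hδ : ∀ v, 3 ≤ G.degree v) (v₀ : V) :
    ∃ D : Finset V, (G.induce (D : Set V)).Connected ∧ G.outside D = ∅ ∧
      4 * D.card + 2 * G.degree v₀ + 1 ≤ 3 * Fintype.card V := by
  -- Dead vertices are credited one unit each. When nothing is outside, the whole first layer is
  -- dead and the value is `4|D| - n + 2`; comparison with the start `{v₀}` then gives the bound.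
  -- The surcharge 2 strengthens the conclusion and is paid by the vertices that die in the last
  -- step.
  let f : Finset V → ℤ := fun D => 2 * (G.outside D).card + 3 * D.card - (G.deadLayer D).card +
    if G.outside D = ∅ then 2 else 0
  obtain ⟨D, hD, hD0, hmin⟩ := exists_lexicographic_min
    (fun D : Finset V => (G.induce (D : Set V)).Connected) f (fun D => (G.outside D).card)
    (connected_induce_singleton v₀)
  have hdead : ∀ D, G.outside D = ∅ → (G.deadLayer D).card = (G.firstLayer D).card := by
    intro D h
    congr 1
    ext v
    simp [mem_deadLayer, h]
  by_cases hW : G.outside D = ∅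
  · refine ⟨D, hD, hW, ?_⟩
    have h1 := card_layers G D
    have h2 := hdead D hW
    have h3 := card_outside_singleton (G := G) v₀
    have h4 := card_firstLayer_singleton (G := G) v₀
    have h5 := hδ v₀
    have h6 := hdead {v₀}
    simp only [f, hW, if_true, Finset.card_empty, Finset.card_singleton] at hD0
    rw [hW, Finset.card_empty] at h1
    split_ifs at hD0 with h7
    · have := h6 h7
      omega
    · omega
  exfalso
  have hf : f D = 2 * (G.outside D).card + 3 * D.card - (G.deadLayer D).card := by
    simp only [f, hW, if_false, add_zero]
  -- The change is at most `3 - 2 * 2 < 0`; if nothing remains outside, the two or more newly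
  -- covered vertices are dead and pay for the surcharge.
  have hone : ∀ u ∈ G.firstLayer D, ((G.outside D).filter (G.Adj u)).card < 2 := by
    intro u hu
    by_contra! h2
    have hud : u ∉ G.deadLayer D := by
      obtain ⟨w, hw⟩ := Finset.card_pos.mp (by omega : 0 < ((G.outside D).filter (G.Adj u)).card)
      obtain ⟨hw, huw⟩ := Finset.mem_filter.mp hw
      exact fun h => (mem_deadLayer.mp h).2 w hw huw
    have h3 := card_outside_insert hu
    have h4 := Finset.card_le_card (deadLayer_subset_insert hud)
    have h6 := card_deadLayer_add_le hud
    have h7 := Finset.card_insert_of_notMem (mem_firstLayer.mp hu).1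
    have h5 := hmin _ (connected_induce_insert hD hu) (by
      rw [hf]
      simp only [f]
      split_ifs with h
      · have := h6 h
        omega
      · omega)
    omega
  have hnd : ∀ u w, w ∈ G.outside D → G.Adj u w → u ∉ G.deadLayer D := fun u w hw h h' =>
    (mem_deadLayer.mp h').2 w hw h
  obtain ⟨d, hd⟩ := hD.nonempty
  obtain ⟨w, hw, u, huW, hwu⟩ := exists_adj_outside hG (Finset.nonempty_iff_ne_empty.mpr hW)
    ⟨d, fun h => (mem_outside.mp h).1 hd⟩
  have hu : u ∈ G.firstLayer D := by
    rcases mem_or_mem_firstLayer_or_mem_outside G D u with h | h | h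
    · exact absurd hwu ((mem_outside.mp hw).2 u h)
    · exact h
    · exact absurd h huW
  have hud := hnd u w hw hwu.symm
  have hu1 : ((G.outside D).filter (G.Adj u)).card = 1 := by
    have := hone u hu
    have : 0 < ((G.outside D).filter (G.Adj u)).card :=
      Finset.card_pos.mpr ⟨w, Finset.mem_filter.mpr ⟨hw, hwu.symm⟩⟩
    omega
  have hdeg := degree_eq_of_mem_outside hw
  have hδw := hδ w
  have hcardu := card_outside_insert hu
  have hDu := Finset.card_insert_of_notMem (mem_firstLayer.mp hu).1
  have hk : 0 < ((G.firstLayer D).filter (G.Adj w)).card :=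
    Finset.card_pos.mpr ⟨u, Finset.mem_filter.mpr ⟨hu, hwu⟩⟩
  -- With one neighbor `u` of `w` in the first layer, `u` and `w` are added: cost 6, and at least
  -- three vertices are covered. With several, only `u` is added: cost 3, one vertex covered, and
  -- the other neighbors of `w` in the first layer die, since `w` was their only neighbor outside.
  by_cases hk1 : ((G.firstLayer D).filter (G.Adj w)).card = 1
  · have hwL := mem_firstLayer_insert_of_mem_outside hw hwu.symm
    have h5 := card_outside_insert hwL
    have hDw := Finset.card_insert_of_notMem (mem_firstLayer.mp hwL).1
    have h7 : (G.outside D).filter (G.Adj w) ⊆ (G.outside (insert u D)).filter (G.Adj w) := by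
      intro z hz
      obtain ⟨hz, hwz⟩ := Finset.mem_filter.mp hz
      refine Finset.mem_filter.mpr ⟨mem_outside_insert.mpr ⟨hz, ?_, fun huz => ?_⟩, hwz⟩
      · rintro rfl
        exact huW hz
      · exact hwz.ne (eq_of_card_filter_lt_two (hone u hu) hw hz hwu.symm huz)
    have h8 := Finset.card_le_card h7
    have hwd : w ∉ G.deadLayer (insert u D) := by
      obtain ⟨z, hz⟩ := Finset.card_pos.mp
        (by omega : 0 < ((G.outside (insert u D)).filter (G.Adj w)).card)
      obtain ⟨hz, hwz⟩ := Finset.mem_filter.mp hz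
      exact fun h => (mem_deadLayer.mp h).2 z hz hwz
    have h9 := Finset.card_le_card (deadLayer_subset_insert hud)
    have h10 := Finset.card_le_card (deadLayer_subset_insert hwd)
    have h11 := card_deadLayer_add_le hwd
    have h12 := hmin _ (connected_induce_insert (connected_induce_insert hD hu) hwL) (by
      rw [hf]
      simp only [f]
      split_ifs with h
      · have := h11 h
        omega
      · omega)
    omega
  · have hsub : G.deadLayer D ∪ ((G.firstLayer D).filter (G.Adj w)).erase u ⊆
        G.deadLayer (insert u D) := by
      refine Finset.union_subset (deadLayer_subset_insert hud) fun x hx => ?_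
      obtain ⟨hxu, hx⟩ := Finset.mem_erase.mp hx
      obtain ⟨hx, hwx⟩ := Finset.mem_filter.mp hx
      obtain ⟨hxD, d', hd', hxd⟩ := mem_firstLayer.mp hx
      refine mem_deadLayer.mpr ⟨mem_firstLayer.mpr ⟨?_, d', Finset.mem_insert_of_mem hd', hxd⟩, ?_⟩
      · rw [Finset.mem_insert, not_or]
        exact ⟨hxu, hxD⟩
      · intro z hz hxz
        obtain ⟨hz, -, huz⟩ := mem_outside_insert.mp hz
        have := eq_of_card_filter_lt_two (hone x hx) hw hz hwx.symm hxz
        exact huz (this ▸ hwu.symm)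
    have hdisj : Disjoint (G.deadLayer D) (((G.firstLayer D).filter (G.Adj w)).erase u) := by
      rw [Finset.disjoint_right]
      intro x hx
      obtain ⟨-, hx⟩ := Finset.mem_erase.mp hx
      exact hnd x w hw (Finset.mem_filter.mp hx).2.symm
    have hce := Finset.card_erase_of_mem (s := (G.firstLayer D).filter (G.Adj w))
      (Finset.mem_filter.mpr ⟨hu, hwu⟩)
    have h1 := Finset.card_le_card hsub
    rw [Finset.card_union_of_disjoint hdisj] at h1
    -- In the last step `w` is the only vertex outside, so its three or more neighbors lie in the
    -- first layer. All but `u` die, and so does `w`, which offsets the surcharge.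
    have h2 : G.outside (insert u D) = ∅ → ((G.outside D).filter (G.Adj w)).card = 0 ∧
        (G.deadLayer D).card + (((G.firstLayer D).filter (G.Adj w)).erase u).card + 1 ≤
          (G.deadLayer (insert u D)).card := by
      intro h
      constructor
      · rw [h, Finset.card_empty] at hcardu
        rw [Finset.card_eq_zero, Finset.filter_eq_empty_iff]
        intro z hz hwz
        have : (G.outside D).card ≤ 1 := by omega
        exact hwz.ne (Finset.card_le_one.mp this w hw z hz)
      · rw [← Finset.card_union_of_disjoint hdisj, ← Finset.card_insert_of_notMem (a := w)]
        · refine Finset.card_le_card (Finset.insert_subset ?_ hsub)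
          exact mem_deadLayer.mpr ⟨mem_firstLayer_insert_of_mem_outside hw hwu.symm, by simp [h]⟩
        · intro hw'
          rcases Finset.mem_union.mp hw' with hw' | hw'
          · exact notMem_outside_of_mem_firstLayer (mem_deadLayer.mp hw').1 hw
          · exact notMem_outside_of_mem_firstLayer
              (Finset.mem_filter.mp (Finset.mem_erase.mp hw').2).1 hw
    have h12 := hmin _ (connected_induce_insert hD hu) (by
      rw [hf]
      simp only [f]
      split_ifs with h
      · have := h2 h
        omega
      · omega)
    omega

end Selection

/-! ### The upper bounds -/

section UpperBounds

variable {V : Type*} [Fintype V] {G : SimpleGraph V} [DecidableRel G.Adj]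

/-- The degree condition leaves three neighbors in `D` and the first layer. With at most one
neighbor outside it holds for minimum degree 4; for minimum degree 3 it requires that nothing is
outside. -/
theorem rainbowIndex_le_of_layers [DecidableEq V] {D : Finset V}
    (hD : (G.induce (D : Set V)).Connected)
    (hone : ∀ u ∈ G.firstLayer D, ((G.outside D).filter (G.Adj u)).card < 2)
    (htwo : ∀ w ∈ G.outside D, 2 ≤ ((G.firstLayer D).filter (G.Adj w)).card)
    (hdeg : ∀ u ∈ G.firstLayer D, 3 + ((G.outside D).filter (G.Adj u)).card ≤ G.degree u) :
    rainbowIndex 3 G + 1 ≤ D.card + (6 + ((G.outside D).card + 1) / 2) := by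
  refine rainbowIndex_le_of_two_layers hD (mem_or_mem_firstLayer_or_mem_outside G D)
    (fun v hv => (mem_firstLayer.mp hv).1) (fun v hv => (mem_outside.mp hv).1)
    (fun v hv hv' => notMem_outside_of_mem_firstLayer hv' hv)
    (fun v hv => (mem_firstLayer.mp hv).2) ?_ ?_ ?_
  · intro v hv p q
    have h1 : ((insert p (insert q ((G.outside D).filter (G.Adj v)))) : Finset V).card <
        (G.neighborFinset v).card := by
      rw [card_neighborFinset_eq_degree]
      have h2 := Finset.card_insert_le p (insert q ((G.outside D).filter (G.Adj v)))
      have h3 := Finset.card_insert_le q ((G.outside D).filter (G.Adj v))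
      have h4 := hdeg v hv
      omega
    obtain ⟨y, hy, hy'⟩ := Finset.exists_mem_notMem_of_card_lt_card h1
    rw [mem_neighborFinset] at hy
    simp only [Finset.mem_insert, Finset.mem_filter, not_or] at hy'
    refine ⟨y, ?_, hy, hy'.1, hy'.2.1⟩
    have := mem_or_mem_firstLayer_or_mem_outside G D y
    tauto
  · intro u hu w hw w' hw' h h'
    exact eq_of_card_filter_lt_two (hone u hu) hw hw' h.symm h'.symm
  · intro w hw
    obtain ⟨r, hr, s, hs, hrs⟩ := Finset.one_lt_card.mp (htwo w hw)
    rw [Finset.mem_filter] at hr hs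
    exact ⟨r, hr.1, s, hs.1, hrs, hr.2, hs.2⟩

theorem even_card_of_degree_eq {d : ℕ} (hd : Odd d) (h : ∀ v, G.degree v = d) :
    Even (Fintype.card V) := by
  have h1 := G.sum_degrees_eq_twice_card_edges
  simp only [h, Finset.sum_const, Finset.card_univ, smul_eq_mul] at h1
  have h2 : Even (Fintype.card V * d) := ⟨_, h1.trans (two_mul _)⟩
  rcases Nat.even_mul.mp h2 with h3 | h3
  · exact h3
  · exact absurd h3 (Nat.not_even_iff_odd.mpr hd)

theorem exists_degree_lt_or_forall_degree_eq {d : ℕ} (h : ∀ v, d ≤ G.degree v) (v₀ : V) :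
    (∃ v, d < G.degree v) ∨ (G.degree v₀ = d ∧ ∀ v, G.degree v = d) := by
  by_cases h1 : ∃ v, d < G.degree v
  · exact Or.inl h1
  · push Not at h1
    have : ∀ v, G.degree v = d := fun v => le_antisymm (h1 v) (h v)
    exact Or.inr ⟨this v₀, this⟩

/-- A start of degree at least 4 gives the constant 12 outright. A cubic graph gives only 13, but
then `n` is even, and parity removes the excess. -/
theorem four_mul_rainbowIndex_le (hG : G.Connected) (hδ : ∀ v, 3 ≤ G.degree v) :
    4 * rainbowIndex 3 G ≤ 3 * Fintype.card V + 12 := by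
  classical
  obtain ⟨v₀⟩ := hG.nonempty
  have key : ∀ v, 4 * rainbowIndex 3 G + 2 * G.degree v + 1 ≤ 3 * Fintype.card V + 20 := by
    intro v
    obtain ⟨D, hD, hW, hcard⟩ := exists_connected_dominating hG hδ v
    have h1 := rainbowIndex_le_of_layers hD (by simp [hW]) (by simp [hW])
      (fun u _ => by simpa [hW] using hδ u)
    rw [hW, Finset.card_empty] at h1
    omega
  rcases exists_degree_lt_or_forall_degree_eq hδ v₀ with ⟨v, hv⟩ | ⟨-, h⟩
  · have := key v
    omega
  · obtain ⟨e, he⟩ := even_card_of_degree_eq (by decide) h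
    have := key v₀
    rw [h] at this
    omega

/-- The factor `k` is at most the minimum degree plus one. The potential `3t + kD` with `k ≤ 6` is
at least `k (D + t / 2)`, which is the quantity that bounds the index. -/
theorem exists_connected_rainbowIndex_le (hG : G.Connected) {k : ℕ} (h4 : 5 ≤ k) (h6 : k ≤ 6)
    (hδ : ∀ v, k ≤ G.degree v + 1) (v₀ : V) :
    ∃ D t : ℕ, 3 * t + k * D + 3 * G.degree v₀ + 3 ≤ 3 * Fintype.card V + k ∧
      rainbowIndex 3 G + 1 ≤ D + (6 + (t + 1) / 2) := by
  classical
  obtain ⟨D, hD, hcard, hone, htwo⟩ := exists_connected_of_degree hG (by omega) h6 hδ v₀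
  refine ⟨D.card, (G.outside D).card, ?_, rainbowIndex_le_of_layers hD hone htwo ?_⟩
  · have := card_outside_singleton (G := G) v₀
    omega
  · intro u hu
    have := hone u hu
    have := hδ u
    omega

theorem five_mul_rainbowIndex_le (hG : G.Connected) (hδ : ∀ v, 4 ≤ G.degree v) :
    5 * rainbowIndex 3 G ≤ 3 * Fintype.card V + 17 := by
  obtain ⟨v₀⟩ := hG.nonempty
  obtain ⟨D, t, h1, h2⟩ := exists_connected_rainbowIndex_le hG (k := 5) le_rfl (by omega)
    (fun v => by have := hδ v; omega) v₀
  have := hδ v₀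
  omega

theorem two_mul_rainbowIndex_le (hG : G.Connected) (hδ : ∀ v, 5 ≤ G.degree v) :
    2 * rainbowIndex 3 G ≤ Fintype.card V + 6 := by
  obtain ⟨v₀⟩ := hG.nonempty
  have key := exists_connected_rainbowIndex_le hG (k := 6) (by omega) le_rfl
    (fun v => by have := hδ v; omega)
  rcases exists_degree_lt_or_forall_degree_eq hδ v₀ with ⟨v, hv⟩ | ⟨-, h⟩
  · obtain ⟨D, t, h1, h2⟩ := key v
    omega
  · obtain ⟨e, he⟩ := even_card_of_degree_eq (by decide) h
    obtain ⟨D, t, h1, h2⟩ := key v₀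
    rw [h] at h1
    omega

end UpperBounds

/-! ### The lower bound and the chain of cliques -/

theorem dist_le_rainbowIndex {V : Type*} [Fintype V] {G : SimpleGraph V} (hG : G.Connected)
    (h3 : 3 ≤ Fintype.card V) (u v : V) : G.dist u v ≤ rainbowIndex 3 G := by
  classical
  obtain ⟨c, hc⟩ := exists_isRainbowColoring_rainbowIndex 3 hG
  -- The third vertex is irrelevant; it only completes the pair to a set of three.
  obtain ⟨S, hS, -, hS3⟩ := Finset.exists_subsuperset_card_eq (s := {u, v}) (n := 3)
    (Finset.subset_univ _) (Finset.card_le_two.trans (by norm_num)) (by simpa using h3)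
  obtain ⟨T, hT, hTS, hTc⟩ := hc S hS3
  have hu : u ∈ T.verts := hTS u (hS (by simp))
  have hv : v ∈ T.verts := hTS v (hS (by simp))
  obtain ⟨p, hp⟩ := hT.connected.exists_isPath ⟨u, hu⟩ ⟨v, hv⟩
  let q : G.Walk u v := p.map T.hom
  have hq : q.IsPath := hp.map T.hom_injective
  have hqT : ∀ e ∈ q.edges, e ∈ T.edgeSet := by
    intro e he
    have hqe : q.edges = p.edges.map (Sym2.map T.hom) := Walk.edges_map T.hom p
    rw [hqe, List.mem_map] at he
    obtain ⟨e', he', rfl⟩ := he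
    have h1 := p.edges_subset_edgeSet he'
    induction e' with
    | h a b => exact h1
  let col : Fin q.edges.length → Fin (rainbowIndex 3 G) := fun i =>
    c ⟨q.edges[i], q.edges_subset_edgeSet (List.getElem_mem _)⟩
  have hcol : Function.Injective col := by
    intro i j hij
    have h1 := hTc _ _ (hqT _ (List.getElem_mem i.2)) (hqT _ (List.getElem_mem j.2)) hij
    have h2 : q.edges[i] = q.edges[j] := congrArg Subtype.val h1
    exact Fin.ext ((List.Nodup.getElem_inj_iff hq.isTrail.edges_nodup).mp h2)
  have h1 := Fintype.card_le_of_injective col hcol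
  rw [Fintype.card_fin, Fintype.card_fin, Walk.length_edges] at h1
  exact (dist_le q).trans h1

namespace CliqueChain

variable {d m : ℕ}

/-- The vertex of label `a` in the block number `i`. -/
def mk (i a : ℕ) (hi : i < m + 2) (ha : a ≤ d) : CliqueChainVertex d m :=
  ⟨⟨i, hi⟩, ⟨a, by split_ifs <;> omega⟩⟩

theorem ext_iff {x y : CliqueChainVertex d m} :
    x = y ↔ x.1.val = y.1.val ∧ x.2.val = y.2.val := by
  constructor
  · rintro rfl
    exact ⟨rfl, rfl⟩
  · obtain ⟨i, a⟩ := x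
    obtain ⟨j, b⟩ := y
    rintro ⟨h1, h2⟩
    obtain rfl : i = j := Fin.ext h1
    obtain rfl : a = b := Fin.ext h2
    rfl

theorem adj_iff {x y : CliqueChainVertex d m} : (cliqueChain d m).Adj x y ↔
    (x.1.val = y.1.val ∧ x.2.val ≠ y.2.val ∧ ¬ (x.2.val = 0 ∧ y.2.val = 1) ∧
      ¬ (x.2.val = 1 ∧ y.2.val = 0)) ∨
    (x.1.val + 1 = y.1.val ∧ x.2.val = 1 ∧ y.2.val = 0) ∨
    (y.1.val + 1 = x.1.val ∧ y.2.val = 1 ∧ x.2.val = 0) := by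
  rw [← Fin.ext_iff]
  rfl

/-- The height of a label within its block. -/
def labelHeight (a : ℕ) : ℕ := if a = 0 then 0 else if a = 1 then 2 else 1

/-- A height function on the chain of cliques. -/
def height (x : CliqueChainVertex d m) : ℕ := 3 * x.1.val + labelHeight x.2.val

/-- The missing edge between the labels 0 and 1 is what makes this true: these labels differ in
height by 2 within a block. -/
theorem height_le_of_adj {x y : CliqueChainVertex d m} (h : (cliqueChain d m).Adj x y) :
    height y ≤ height x + 1 := by
  rw [adj_iff] at h
  unfold height labelHeight
  generalize x.2.val = a at *
  generalize y.2.val = b at *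
  split_ifs <;> omega

theorem height_le_add_length {x y : CliqueChainVertex d m} (p : (cliqueChain d m).Walk x y) :
    height y ≤ height x + p.length := by
  induction p with
  | nil => simp
  | cons h p ih =>
    have := height_le_of_adj h
    rw [Walk.length_cons]
    omega

/-- There is a walk from `x` to `y` that is not longer than the difference of the heights. -/
def Climbs (x y : CliqueChainVertex d m) : Prop :=
  ∃ p : (cliqueChain d m).Walk x y, height x + p.length ≤ height y

theorem Climbs.trans {x y z : CliqueChainVertex d m} (h : Climbs x y) (h' : Climbs y z) :
    Climbs x z := by
  obtain ⟨p, hp⟩ := h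
  obtain ⟨q, hq⟩ := h'
  refine ⟨p.append q, ?_⟩
  rw [Walk.length_append]
  omega

theorem Climbs.refl (x : CliqueChainVertex d m) : Climbs x x := ⟨.nil, by simp⟩

theorem Climbs.of_adj {x y : CliqueChainVertex d m} (h : (cliqueChain d m).Adj x y)
    (hxy : height x + 1 ≤ height y) : Climbs x y :=
  ⟨h.toWalk, by simpa using hxy⟩

theorem climbs_last (hd : 3 ≤ d) (x : CliqueChainVertex d m) :
    Climbs x (mk x.1.val 1 x.1.2 (by omega)) := by
  have key : ∀ y : CliqueChainVertex d m, y.2.val ≠ 0 →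
      Climbs y (mk y.1.val 1 y.1.2 (by omega)) := by
    intro y hy
    by_cases h1 : y.2.val = 1
    · have : y = mk y.1.val 1 y.1.2 (by omega) := ext_iff.mpr ⟨rfl, h1⟩
      rw [← this]
      exact .refl y
    · refine .of_adj (adj_iff.mpr (Or.inl ⟨rfl, h1, ?_⟩)) ?_
      · simp only [mk]
        omega
      · simp only [height, labelHeight, mk, hy, h1, if_false, one_ne_zero, if_true]
        omega
  by_cases h0 : x.2.val = 0
  · refine Climbs.trans ?_ (key (mk x.1.val 2 x.1.2 (by omega)) (by simp [mk]))
    refine .of_adj (adj_iff.mpr (Or.inl ⟨rfl, ?_⟩)) ?_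
    · simp only [mk]
      omega
    · simp [height, labelHeight, mk, h0]
  · exact key x h0

theorem first_climbs (hd : 3 ≤ d) (y : CliqueChainVertex d m) :
    Climbs (mk y.1.val 0 y.1.2 (by omega)) y := by
  have key : ∀ y : CliqueChainVertex d m, y.2.val ≠ 1 →
      Climbs (mk y.1.val 0 y.1.2 (by omega)) y := by
    intro y hy
    by_cases h0 : y.2.val = 0
    · have : y = mk y.1.val 0 y.1.2 (by omega) := ext_iff.mpr ⟨rfl, h0⟩
      rw [← this]
      exact .refl y
    · refine .of_adj (adj_iff.mpr (Or.inl ⟨rfl, ?_⟩)) ?_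
      · simp only [mk]
        omega
      · simp [height, labelHeight, mk, hy, h0]
  by_cases h1 : y.2.val = 1
  · refine Climbs.trans (key (mk y.1.val 2 y.1.2 (by omega)) (by simp [mk])) ?_
    refine .of_adj (adj_iff.mpr (Or.inl ⟨rfl, ?_⟩)) ?_
    · simp only [mk]
      omega
    · simp [height, labelHeight, mk, h1]
  · exact key y h1

theorem climbs_of_lt (hd : 3 ≤ d) (x : CliqueChainVertex d m) :
    ∀ j (hj : j < m + 2), x.1.val < j → Climbs x (mk j 0 hj (by omega)) := by
  have step : ∀ j (hj : j < m + 2) (hj' : j + 1 < m + 2),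
      Climbs (mk j 1 hj (by omega) : CliqueChainVertex d m) (mk (j + 1) 0 hj' (by omega)) := by
    intro j hj hj'
    refine .of_adj (adj_iff.mpr (Or.inr (Or.inl ⟨rfl, rfl, rfl⟩))) ?_
    simp only [height, labelHeight, mk, one_ne_zero, if_true, if_false]
    omega
  intro j
  induction j with
  | zero => intro _ h; omega
  | succ j ih =>
    intro hj hlt
    rcases Nat.lt_succ_iff_lt_or_eq.mp hlt with h | h
    · exact ((ih (by omega) h).trans (climbs_last hd _)).trans (step j (by omega) hj)
    · subst h
      exact (climbs_last hd x).trans (step _ _ hj)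

/-- Between different blocks a walk can climb one unit of height per step, and the total height is
`3m + 5`. Within a block the heights do not suffice, but nonadjacent vertices are joined through the
label 2. -/
theorem exists_walk (hd : 3 ≤ d) (x y : CliqueChainVertex d m) :
    ∃ p : (cliqueChain d m).Walk x y, p.length ≤ 3 * m + 5 := by
  have hlt : ∀ x y : CliqueChainVertex d m, x.1.val < y.1.val →
      ∃ p : (cliqueChain d m).Walk x y, p.length ≤ 3 * m + 5 := by
    intro x y h
    obtain ⟨p, hp⟩ := (climbs_of_lt hd x _ y.1.2 h).trans (first_climbs hd y)
    refine ⟨p, ?_⟩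
    have : height y ≤ 3 * m + 5 := by
      have := y.1.2
      unfold height labelHeight
      generalize y.2.val = b
      split_ifs <;> omega
    omega
  rcases lt_trichotomy x.1.val y.1.val with h | h | h
  · exact hlt x y h
  · by_cases hxy : x = y
    · subst hxy
      exact ⟨.nil, by simp⟩
    by_cases hadj : (cliqueChain d m).Adj x y
    · exact ⟨hadj.toWalk, by simp⟩
    · have hne : ¬ (x.2.val = y.2.val) := fun h2 => hxy (ext_iff.mpr ⟨h, h2⟩)
      rw [adj_iff] at hadj
      have h1 : (cliqueChain d m).Adj x (mk x.1.val 2 x.1.2 (by omega)) :=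
        adj_iff.mpr (Or.inl ⟨rfl, by simp only [mk]; omega⟩)
      have h2 : (cliqueChain d m).Adj (mk x.1.val 2 x.1.2 (by omega)) y :=
        adj_iff.mpr (Or.inl ⟨h, by simp only [mk]; omega⟩)
      exact ⟨.cons h1 h2.toWalk, by simp⟩
  · obtain ⟨p, hp⟩ := hlt y x h
    exact ⟨p.reverse, by simpa using hp⟩

theorem connected (hd : 3 ≤ d) : (cliqueChain d m).Connected where
  preconnected x y := ⟨(exists_walk hd x y).choose⟩
  nonempty := ⟨mk 0 0 (by omega) (by omega)⟩

theorem diam_eq (hd : 3 ≤ d) : (cliqueChain d m).diam = 3 * m + 5 := by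
  have hne : Nonempty (CliqueChainVertex d m) := (connected hd).nonempty
  apply le_antisymm
  · obtain ⟨x, y, hxy⟩ := (cliqueChain d m).exists_dist_eq_diam
    obtain ⟨p, hp⟩ := exists_walk hd x y
    rw [← hxy]
    exact (dist_le p).trans hp
  · have h := dist_le_diam (connected_iff_ediam_ne_top.mp (connected hd))
      (u := (mk 0 0 (by omega) (by omega) : CliqueChainVertex d m))
      (v := mk (m + 1) 1 (by omega) (by omega))
    refine le_trans ?_ h
    obtain ⟨p, hp⟩ := (connected hd).exists_walk_length_eq_dist
      (mk 0 0 (by omega) (by omega) : CliqueChainVertex d m) (mk (m + 1) 1 (by omega) (by omega))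
    have h1 := height_le_add_length p
    have h2 : height (mk 0 0 (by omega) (by omega) : CliqueChainVertex d m) = 0 := by
      simp [height, labelHeight, mk]
    have h3 : height (mk (m + 1) 1 (by omega) (by omega) : CliqueChainVertex d m) = 3 * m + 5 := by
      simp only [height, labelHeight, mk, one_ne_zero, if_true, if_false]
      omega
    rw [h2, h3, hp] at h1
    omega

theorem card_eq : Fintype.card (CliqueChainVertex d m) = (d + 1) * m + 2 * (d + 2) := by
  have h : ∀ i : Fin (m + 2), (if i = 0 ∨ i = Fin.last (m + 1) then d + 2 else d + 1) =
      (d + 1) + if i ∈ ({0, Fin.last (m + 1)} : Finset (Fin (m + 2))) then 1 else 0 := by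
    intro i
    simp only [Finset.mem_insert, Finset.mem_singleton]
    split_ifs <;> rfl
  rw [Fintype.card_sigma]
  simp only [Fintype.card_fin]
  rw [Finset.sum_congr rfl fun i _ => h i, Finset.sum_add_distrib, Finset.sum_ite_mem,
    Finset.univ_inter, Finset.sum_const, Finset.sum_const, Finset.card_univ, Fintype.card_fin,
    Finset.card_pair (Fin.ne_of_val_ne (by simp))]
  simp only [smul_eq_mul]
  ring

theorem diam_le_rainbowIndex (hd : 3 ≤ d) :
    (cliqueChain d m).diam ≤ rainbowIndex 3 (cliqueChain d m) := by
  have hne : Nonempty (CliqueChainVertex d m) := (connected hd).nonempty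
  obtain ⟨x, y, hxy⟩ := (cliqueChain d m).exists_dist_eq_diam
  rw [← hxy]
  refine dist_le_rainbowIndex (connected hd) ?_ x y
  rw [card_eq]
  omega

/-- The vertices of the block of `x`. -/
def block (x : CliqueChainVertex d m) : Finset (CliqueChainVertex d m) :=
  Finset.univ.map (Function.Embedding.sigmaMk x.1)

theorem mem_block {x y : CliqueChainVertex d m} : y ∈ block x ↔ x.1.val = y.1.val := by
  unfold block
  rw [Finset.mem_map]
  constructor
  · rintro ⟨a, -, rfl⟩
    rfl
  · intro h
    obtain ⟨j, b⟩ := y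
    obtain rfl : x.1 = j := Fin.ext h
    exact ⟨b, Finset.mem_univ _, rfl⟩

theorem card_block (x : CliqueChainVertex d m) :
    (block x).card = if x.1 = 0 ∨ x.1 = Fin.last (m + 1) then d + 2 else d + 1 := by
  rw [block, Finset.card_map, Finset.card_univ, Fintype.card_fin]

theorem le_degree (hd : 3 ≤ d) (x : CliqueChainVertex d m) : d ≤ (cliqueChain d m).degree x := by
  rw [← card_neighborFinset_eq_degree]
  have hc := card_block x
  have hx : x ∈ block x := mem_block.mpr rfl
  by_cases h2 : 2 ≤ x.2.val
  · have hsub : (block x).erase x ⊆ (cliqueChain d m).neighborFinset x := by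
      intro y hy
      obtain ⟨hyx, hy⟩ := Finset.mem_erase.mp hy
      rw [mem_neighborFinset, adj_iff]
      rw [mem_block] at hy
      refine Or.inl ⟨hy, fun h => hyx (ext_iff.mpr ⟨hy.symm, h.symm⟩), by omega, by omega⟩
    refine le_trans ?_ (Finset.card_le_card hsub)
    rw [Finset.card_erase_of_mem hx, hc]
    split_ifs <;> omega
  -- The label `1 - x.2.val` belongs to the other end of the deleted edge. In a middle block the
  -- edge to the neighboring block makes up for this loss; an end block has an additional vertex
  -- instead.
  let x' : CliqueChainVertex d m := mk x.1.val (1 - x.2.val) x.1.2 (by omega)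
  have hx' : x' ∈ (block x).erase x := by
    refine Finset.mem_erase.mpr ⟨fun h => ?_, mem_block.mpr rfl⟩
    have := (ext_iff.mp h).2
    simp only [x', mk] at this
    omega
  have hsub : ((block x).erase x).erase x' ⊆ (cliqueChain d m).neighborFinset x := by
    intro y hy
    obtain ⟨hyx', hy⟩ := Finset.mem_erase.mp hy
    obtain ⟨hyx, hy⟩ := Finset.mem_erase.mp hy
    rw [mem_neighborFinset, adj_iff]
    rw [mem_block] at hy
    have h1 : y.2.val ≠ x.2.val := fun h => hyx (ext_iff.mpr ⟨hy.symm, h⟩)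
    have h3 : y.2.val ≠ 1 - x.2.val := fun h => hyx' (ext_iff.mpr ⟨hy.symm, h⟩)
    exact Or.inl ⟨hy, h1.symm, by omega, by omega⟩
  have hcard : (((block x).erase x).erase x').card = (block x).card - 2 := by
    rw [Finset.card_erase_of_mem hx', Finset.card_erase_of_mem hx]
    omega
  by_cases hend : x.1 = 0 ∨ x.1 = Fin.last (m + 1)
  · rw [if_pos hend] at hc
    have := Finset.card_le_card hsub
    omega
  · rw [if_neg hend] at hc
    have hx1 := x.1.2
    rw [not_or] at hend
    have h0 : x.1.val ≠ 0 := fun h => hend.1 (Fin.ext h)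
    have h1 : x.1.val ≠ m + 1 := fun h => hend.2 (Fin.ext h)
    have hy : ∃ y, (cliqueChain d m).Adj x y ∧ y ∉ block x := by
      by_cases hx0 : x.2.val = 0
      · refine ⟨mk (x.1.val - 1) 1 (by omega) (by omega), adj_iff.mpr (Or.inr (Or.inr
          ⟨?_, rfl, hx0⟩)), ?_⟩
        · simp only [mk]
          omega
        · rw [mem_block]
          simp only [mk]
          omega
      · refine ⟨mk (x.1.val + 1) 0 (by omega) (by omega), adj_iff.mpr (Or.inr (Or.inl
          ⟨rfl, by omega, rfl⟩)), ?_⟩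
        rw [mem_block]
        simp only [mk]
        omega
    obtain ⟨y, hxy, hyb⟩ := hy
    have hsub' : insert y (((block x).erase x).erase x') ⊆
        (cliqueChain d m).neighborFinset x :=
      Finset.insert_subset ((mem_neighborFinset _ _ _).mpr hxy) hsub
    have := Finset.card_le_card hsub'
    rw [Finset.card_insert_of_notMem fun h =>
      hyb (Finset.mem_of_mem_erase (Finset.mem_of_mem_erase h))] at this
    omega

theorem minDegree_eq (hd : 3 ≤ d) : (cliqueChain d m).minDegree = d := by
  have hne : Nonempty (CliqueChainVertex d m) := (connected hd).nonempty
  apply le_antisymm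
  · let x : CliqueChainVertex d m := mk 0 0 (by omega) (by omega)
    let x' : CliqueChainVertex d m := mk 0 1 (by omega) (by omega)
    refine ((cliqueChain d m).minDegree_le_degree x).trans ?_
    rw [← card_neighborFinset_eq_degree]
    have hx : x ∈ block x := mem_block.mpr rfl
    have hx' : x' ∈ (block x).erase x := by
      refine Finset.mem_erase.mpr ⟨fun h => ?_, mem_block.mpr rfl⟩
      have := (ext_iff.mp h).2
      simp [x, x', mk] at this
    have hsub : (cliqueChain d m).neighborFinset x ⊆ ((block x).erase x).erase x' := by
      intro y hy
      rw [mem_neighborFinset, adj_iff] at hy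
      rcases hy with ⟨h1, h2, h3, -⟩ | ⟨-, h, -⟩ | ⟨h, -⟩
      · refine Finset.mem_erase.mpr ⟨fun h => ?_, Finset.mem_erase.mpr ⟨fun h => ?_,
          mem_block.mpr h1⟩⟩
        · exact h3 ⟨rfl, (ext_iff.mp h).2⟩
        · exact h2 (ext_iff.mp h).2.symm
      · simp [x, mk] at h
      · simp [x, mk] at h
    have hcard : (block x).card = d + 2 :=
      (card_block x).trans (if_pos (Or.inl (Fin.ext rfl)))
    refine (Finset.card_le_card hsub).trans ?_
    rw [Finset.card_erase_of_mem hx', Finset.card_erase_of_mem hx, hcard]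
    omega
  · exact le_minDegree_of_forall_le_degree _ _ (le_degree hd)

end CliqueChain

theorem CliqueChain.diam_eq_card {d m : ℕ} (hd : 3 ≤ d) :
    ((cliqueChain d m).diam : ℝ) =
      3 / ((d : ℝ) + 1) * (Fintype.card (CliqueChainVertex d m) : ℝ) -
        ((d : ℝ) + 7) / ((d : ℝ) + 1) := by
  have h : (d : ℝ) + 1 ≠ 0 := by positivity
  rw [diam_eq hd, card_eq]
  push_cast
  field_simp
  ring

theorem CliqueChain.exists_le_rainbowIndex {d : ℕ} (hd : 3 ≤ d) (N : ℕ) :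
    ∃ (V : Type) (_ : Fintype V) (G : SimpleGraph V) (_ : DecidableRel G.Adj),
      N ≤ Fintype.card V ∧ G.Connected ∧ G.minDegree = d ∧
        3 / ((d : ℝ) + 1) * (Fintype.card V : ℝ) - ((d : ℝ) + 7) / ((d : ℝ) + 1) ≤
          (rainbowIndex 3 G : ℝ) := by
  refine ⟨CliqueChainVertex d N, inferInstance, cliqueChain d N, inferInstance, ?_,
    connected hd, minDegree_eq hd, ?_⟩
  · rw [card_eq]
    nlinarith
  · rw [← diam_eq_card hd]
    exact_mod_cast diam_le_rainbowIndex hd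

end SimpleGraph

theorem mainTheorem3 :
    -- the upper bounds
    (∀ (V : Type*) [Fintype V] (G : SimpleGraph V) [DecidableRel G.Adj],
      G.Connected →
        (3 ≤ G.minDegree →
          (G.rainbowIndex 3 : ℝ) ≤ 3 / 4 * (Fintype.card V : ℝ) + 3) ∧
        (4 ≤ G.minDegree →
          (G.rainbowIndex 3 : ℝ) ≤ 3 / 5 * (Fintype.card V : ℝ) + 17 / 5) ∧
        (5 ≤ G.minDegree →
          (G.rainbowIndex 3 : ℝ) ≤ 1 / 2 * (Fintype.card V : ℝ) + 3)) ∧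
    -- the chains of cliques
    (∀ d m : ℕ, 3 ≤ d →
      (SimpleGraph.cliqueChain d m).Connected ∧
      (SimpleGraph.cliqueChain d m).minDegree = d ∧
      Fintype.card (SimpleGraph.CliqueChainVertex d m) = (d + 1) * m + 2 * (d + 2) ∧
      ((SimpleGraph.cliqueChain d m).diam : ℝ) =
        3 / ((d : ℝ) + 1) * (Fintype.card (SimpleGraph.CliqueChainVertex d m) : ℝ) -
          ((d : ℝ) + 7) / ((d : ℝ) + 1) ∧
      (SimpleGraph.cliqueChain d m).diam ≤ (SimpleGraph.cliqueChain d m).rainbowIndex 3) ∧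
    -- the upper bounds are tight up to an additive constant
    (∀ N : ℕ, ∃ (V : Type) (_ : Fintype V) (G : SimpleGraph V) (_ : DecidableRel G.Adj),
      N ≤ Fintype.card V ∧ G.Connected ∧ G.minDegree = 3 ∧
        3 / 4 * (Fintype.card V : ℝ) - 5 / 2 ≤ (G.rainbowIndex 3 : ℝ)) ∧
    (∀ N : ℕ, ∃ (V : Type) (_ : Fintype V) (G : SimpleGraph V) (_ : DecidableRel G.Adj),
      N ≤ Fintype.card V ∧ G.Connected ∧ G.minDegree = 4 ∧
        3 / 5 * (Fintype.card V : ℝ) - 11 / 5 ≤ (G.rainbowIndex 3 : ℝ)) ∧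
    (∀ N : ℕ, ∃ (V : Type) (_ : Fintype V) (G : SimpleGraph V) (_ : DecidableRel G.Adj),
      N ≤ Fintype.card V ∧ G.Connected ∧ G.minDegree = 5 ∧
        1 / 2 * (Fintype.card V : ℝ) - 2 ≤ (G.rainbowIndex 3 : ℝ)) := by
  refine ⟨fun V _ G _ hG => ⟨fun h => ?_, fun h => ?_, fun h => ?_⟩, fun d m hd =>
    ⟨SimpleGraph.CliqueChain.connected hd, SimpleGraph.CliqueChain.minDegree_eq hd,
      SimpleGraph.CliqueChain.card_eq, SimpleGraph.CliqueChain.diam_eq_card hd,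
      SimpleGraph.CliqueChain.diam_le_rainbowIndex hd⟩, fun N => ?_, fun N => ?_, fun N => ?_⟩
  · have h1 := SimpleGraph.four_mul_rainbowIndex_le hG
      fun v => h.trans (G.minDegree_le_degree v)
    have h2 : (4 : ℝ) * G.rainbowIndex 3 ≤ 3 * Fintype.card V + 12 := by exact_mod_cast h1
    linarith
  · have h1 := SimpleGraph.five_mul_rainbowIndex_le hG
      fun v => h.trans (G.minDegree_le_degree v)
    have h2 : (5 : ℝ) * G.rainbowIndex 3 ≤ 3 * Fintype.card V + 17 := by exact_mod_cast h1
    linarith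
  · have h1 := SimpleGraph.two_mul_rainbowIndex_le hG
      fun v => h.trans (G.minDegree_le_degree v)
    have h2 : (2 : ℝ) * G.rainbowIndex 3 ≤ Fintype.card V + 6 := by exact_mod_cast h1
    linarith
  · obtain ⟨V, i, G, j, h1, h2, h3, h4⟩ :=
      SimpleGraph.CliqueChain.exists_le_rainbowIndex (d := 3) le_rfl N
    refine ⟨V, i, G, j, h1, h2, h3, ?_⟩
    norm_num at h4 ⊢
    linarith
  · obtain ⟨V, i, G, j, h1, h2, h3, h4⟩ :=
      SimpleGraph.CliqueChain.exists_le_rainbowIndex (d := 4) (by norm_num) N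
    refine ⟨V, i, G, j, h1, h2, h3, ?_⟩
    norm_num at h4 ⊢
    linarith
  · obtain ⟨V, i, G, j, h1, h2, h3, h4⟩ :=
      SimpleGraph.CliqueChain.exists_le_rainbowIndex (d := 5) (by norm_num) N
    refine ⟨V, i, G, j, h1, h2, h3, ?_⟩
    norm_num at h4 ⊢
    linarith
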